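/- Let $H$ be a (real or complex) Hilbert space, let $K\ge 3$, and let $L_1,\dots,L_K$ be closed subspaces of $H$. For a closed subspace $X$ of $H$ let $P(X)$ denote the orthogonal projection of $H$ onto $X$. Suppose that there is a sequence $(w_n)_{n\in\mathbb N}$ in $H$ with $\|w_n\|=1$ for all $n$, with $w_n\to 0$ weakly, and with $$\lim_{n\to\infty}\ \max_{1\le k\le K}\operatorname{dist}(w_n,L_k)=0 .$$ Then there exist closed subspaces $\tilde L_k\subset L_k$ ($1\le k\le K$), a starting point $z_0\in H$, and a sequence of indices $k_1,k_2,\dots\in\{1,\dots,K\}$ in which every $i\in\{1,\dots,K\}$ occurs infinitely often, such that the sequence defined by $z_n=P(\tilde L_{k_n})z_{n-1}$, $n\ge 1$, does not converge in norm. In particular, if the (algebraic) sum $L_1^\perp+\dots+L_K^\perp$ is not closed in $H$, then there exist $\tilde L_k$, $z_0$ and $(k_n)$ with these properties. -/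

import Mathlib

open Filter Topology

noncomputable section

/-- The sequence `z 0 = z₀`, `z (n + 1) = P(M (k n)) (z n)` of iterated orthogonal projections,
where `P(X)` is the orthogonal projection of `H` onto the closed subspace `X`, and the subspaces
are visited in the order `k 0, k 1, k 2, …`. -/
def projIterates {𝕜 : Type*} [RCLike 𝕜] {H : Type*} [NormedAddCommGroup H]
    [InnerProductSpace 𝕜 H] [CompleteSpace H] {ι : Type*} (M : ι → ClosedSubmodule 𝕜 H)
    (k : ℕ → ι) (z₀ : H) : ℕ → H
  | 0 => z₀
  | n + 1 => (M (k n)).toSubmodule.starProjection (projIterates M k z₀ n)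

/-- There are closed subspaces `M i ⊆ L i`, a starting point `z₀` and a sequence of indices
which takes every value infinitely often, such that the iterated projections onto the `M i`
do not converge in norm. -/
def HasDivergentProjections {𝕜 : Type*} [RCLike 𝕜] {H : Type*} [NormedAddCommGroup H]
    [InnerProductSpace 𝕜 H] [CompleteSpace H] {ι : Type*} (L : ι → ClosedSubmodule 𝕜 H) : Prop :=
  ∃ (M : ι → ClosedSubmodule 𝕜 H) (z₀ : H) (k : ℕ → ι),
    (∀ i, M i ≤ L i) ∧ (∀ i, ∃ᶠ n in atTop, k n = i) ∧
      ¬ ∃ z : H, Tendsto (projIterates M k z₀) atTop (𝓝 z)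

end

/-! The iteration travels along orthogonal unit vectors `e 1, e 2, …`: a finite word of projections
carries each `e n` to `e (n + 1)` up to a summable error. Projections are nonexpansive, so errors
only add up, and the iterates are not Cauchy (`hasDivergentProjections_of_words`).

A quarter turn of a plane can be made by projecting onto N lines in turn, each at angle π/(2N) to
the preceding one; the length lost is 1 - cos(π/(2N))^N, which tends to 0. To obtain these line
projections from few subspaces, let X be the projection onto the plane and Z 0 ≥ Z 1 ≥ … a chain of
projections above X, each dropping one more auxiliary direction. Let R tilt the normal p of a line
slightly towards the auxiliary direction a j, which Z (j + 1) kills. Then X R Z (j + 1) R* fixes the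
line and multiplies p by cos² t, so its high powers approach the line projection. The tilts for all
lines fit into one unitary U (`exists_word_near_spokeProduct`, `exists_quarter_turn`).

All the U Z j U* are nearly powers of one positive contraction c², whose eigenvalues approach 1 fast
enough for different exponents to separate them (`exists_chain_operator`). With s² = 1 - c², the
operator c² is the compression to the block of the projection onto the graph {(c x, s x)}. As s is
small, this graph passes close to the block. Consecutive blocks share one main vector and put their
graphs into different subspaces, by parity. On a block, projecting onto the graphs of the other
parity nearly fixes the plane and kills the auxiliary directions, so it acts as X. Three subspaces
therefore suffice: the base space, the even graphs and the odd graphs. The others are spans of main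
vectors and do little.

The model is carried into H by unit vectors `f i k ∈ L k`, orthogonal for different `i` and nearly
equal in `k`, extracted from the weakly null sequence (`exists_orthogonal_close_vectors`). If the
sum of the complements is not closed, such a sequence exists because the sum of the projections onto
them is not bounded below (`exists_weakly_null_of_not_isClosed`). -/

/-! ### Words of nonexpansive maps and their concatenation. -/

section Words

/-- A word of maps which are nonexpansive and intertwined up to `δ` by `J` with maps preserving a
set `B` is intertwined up to `w.length * δ`. -/
theorem norm_foldr_sub_le {α V H : Type*} [NormedAddCommGroup H] (S : α → H → H) (s : α → V → V)
    (J : V → H) (B : Set V) (hs : ∀ l, Set.MapsTo (s l) B B) (δ : ℝ)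
    (hS : ∀ l x y, ‖S l x - S l y‖ ≤ ‖x - y‖) (w : List α)
    (h : ∀ l ∈ w, ∀ x ∈ B, ‖S l (J x) - J (s l x)‖ ≤ δ) {x : V} (hx : x ∈ B) :
    ‖w.foldr S (J x) - J (w.foldr s x)‖ ≤ w.length * δ ∧ w.foldr s x ∈ B := by
  induction w with
  | nil => simpa using hx
  | cons l w ih =>
    obtain ⟨h1, h2⟩ := ih fun l hl => h l (List.mem_cons_of_mem _ hl)
    refine ⟨?_, hs l h2⟩
    simp only [List.foldr_cons, List.length_cons]
    calc _ ≤ ‖S l (w.foldr S (J x)) - S l (J (w.foldr s x))‖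
          + ‖S l (J (w.foldr s x)) - J (s l (w.foldr s x))‖ := norm_sub_le_norm_sub_add_norm_sub _ _ _
      _ ≤ w.length * δ + δ :=
          add_le_add ((hS _ _ _).trans h1) (h l List.mem_cons_self _ h2)
      _ = _ := by push_cast; ring

theorem norm_foldr_sub_foldr_le {α H : Type*} [NormedAddCommGroup H] (S : α → H → H)
    (hS : ∀ l x y, ‖S l x - S l y‖ ≤ ‖x - y‖) (w : List α) (x y : H) :
    ‖w.foldr S x - w.foldr S y‖ ≤ ‖x - y‖ := by
  induction w with
  | nil => simp
  | cons l w ih => exact (hS _ _ _).trans ih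

theorem foldr_flatMap {α β H : Type*} (S : α → H → H) (g : β → List α) (w : List β) (x : H) :
    (w.flatMap g).foldr S x = w.foldr (fun b y => (g b).foldr S y) x := by
  induction w with
  | nil => simp
  | cons l w ih => simp [List.flatMap_cons, List.foldr_append, ih]

theorem foldr_apply_eq_prod {α 𝕜 F : Type*} [NontriviallyNormedField 𝕜] [NormedAddCommGroup F]
    [NormedSpace 𝕜 F] (S : α → F →L[𝕜] F) (w : List α) (x : F) :
    w.foldr (fun l y => S l y) x = (w.map S).prod x := by
  induction w with
  | nil => simp
  | cons l w ih => simp [ih]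

/-- Infinite concatenation of nonempty words. -/
theorem exists_concatenation {α : Type*} (w : ℕ → List α) (hw : ∀ n, w n ≠ []) :
    ∃ (k : ℕ → α) (t : ℕ → ℕ), t 0 = 0 ∧ (∀ n, t (n + 1) = t n + (w n).length) ∧
      ∀ n i (hi : i < (w n).length), k (t n + i) = (w n)[i] := by
  let t : ℕ → ℕ := fun n => ∑ m ∈ Finset.range n, (w m).length
  have ht : ∀ n, t (n + 1) = t n + (w n).length := fun n => Finset.sum_range_succ _ _
  have hlt : ∀ n, t n < t (n + 1) := fun n => by
    have := List.length_pos_iff.2 (hw n)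
    rw [ht]; omega
  have hmono : StrictMono t := strictMono_nat_of_lt_succ hlt
  have hex : ∀ m, ∃ n, m < t (n + 1) := fun m => ⟨m, (Nat.lt_succ_self m).trans_le (hmono.le_apply)⟩
  classical
  have hblock : ∀ n i, i < (w n).length → Nat.find (hex (t n + i)) = n := by
    intro n i hi
    rw [Nat.find_eq_iff]
    refine ⟨by rw [ht]; omega, fun m hm => ?_⟩
    have := hmono.monotone (Nat.succ_le_of_lt hm)
    simp only [Nat.succ_eq_add_one] at this
    omega
  -- A default that only makes the indexing total; the lookups in the claim stay inside their block.
  have x0 : α := (w 0).head (hw 0)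
  refine ⟨fun m => ((w (Nat.find (hex m)))[m - t (Nat.find (hex m))]?).getD x0, t, by simp [t], ht, ?_⟩
  intro n i hi
  simp only [hblock n i hi]
  simp [hi]

end Words

/-! ### Choice of numerical sequences. -/

section Sequences

theorem exists_antitone_pos_le (b : ℕ → ℝ) (hb : ∀ n, 0 < b n) :
    ∃ h : ℕ → ℝ, Antitone h ∧ (∀ n, 0 < h n) ∧ ∀ n, h n ≤ b n := by
  refine ⟨fun n => (Finset.range (n + 1)).inf' ⟨0, by simp⟩ b, ?_, ?_, ?_⟩
  · intro m n hmn
    exact Finset.inf'_mono _ (Finset.range_mono (by omega)) _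
  · intro n
    exact (Finset.lt_inf'_iff _).2 fun i _ => hb i
  · intro n
    exact Finset.inf'_le _ (by simp)

/-- Numbers `1 - τ i` close to `1` together with exponents whose powers separate levels. -/
theorem exists_separating_powers {η ε : ℝ} (hη : 0 < η) (hη1 : η < 1) (hε : 0 < ε) :
    ∃ (τ : ℕ → ℝ) (k : ℕ → ℕ), (∀ i, 0 < τ i) ∧ (∀ i, τ i ≤ η) ∧
      ∀ i j, |(1 - τ i) ^ k j - (if j ≤ i then 1 else 0)| ≤ ε := by
  have hk : ∀ x : ℝ, 0 < x → x < 1 → ∃ k : ℕ, (1 - x) ^ k < ε := fun x h0 h1 =>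
    exists_pow_lt_of_lt_one hε (by linarith)
  let κ : ℝ → ℕ := fun x => if h : 0 < x ∧ x < 1 then (hk x h.1 h.2).choose else 0
  have hκ : ∀ x, 0 < x → x < 1 → (1 - x) ^ κ x < ε := by
    intro x h0 h1
    simp only [κ, dif_pos (And.intro h0 h1)]
    exact (hk x h0 h1).choose_spec
  -- `τ (n + 1)` is so small that the exponent bringing `1 - τ n` below `ε` moves `1 - τ (n + 1)` by
  -- at most `ε` from 1.
  let τ : ℕ → ℝ := fun n => Nat.rec η (fun _ x => min x (ε / (κ x + 1))) n
  have hτs : ∀ n, τ (n + 1) = min (τ n) (ε / (κ (τ n) + 1)) := fun n => rfl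
  have hpos : ∀ n, 0 < τ n := by
    intro n
    induction n with
    | zero => exact hη
    | succ n ih => rw [hτs]; exact lt_min ih (by positivity)
  have hanti : Antitone τ := antitone_nat_of_succ_le fun n => by rw [hτs]; exact min_le_left _ _
  have hle : ∀ n, τ n ≤ η := fun n => hanti (Nat.zero_le n)
  -- Level 0 keeps everything, hence exponent 0; the exponent of level `j + 1` must suppress `τ j`
  -- and all larger values.
  refine ⟨τ, fun j => Nat.casesOn j 0 fun j => κ (τ j), hpos, hle, ?_⟩
  intro i j
  cases j with
  | zero => simp [hε.le]
  | succ j =>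
    have h0 : 0 ≤ 1 - τ i := by linarith [hle i]
    have h1 : 1 - τ i ≤ 1 := by linarith [hpos i]
    simp only
    split_ifs with hji
    · have h2 : τ i * (κ (τ j) + 1) ≤ ε := by
        have : τ i ≤ ε / (κ (τ j) + 1) := (hanti hji).trans (by rw [hτs]; exact min_le_right _ _)
        rwa [le_div_iff₀ (by positivity)] at this
      have h3 := one_add_mul_le_pow (a := -τ i) (by linarith [hle i]) (κ (τ j))
      have h4 : (1 - τ i) ^ κ (τ j) ≤ 1 := pow_le_one₀ h0 h1
      rw [← sub_eq_add_neg] at h3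
      rw [abs_le]
      constructor <;> nlinarith [hpos i]
    · have hij : i ≤ j := by omega
      have h2 := hκ (τ j) (hpos j) ((hle j).trans_lt hη1)
      have h3 : (1 - τ i) ^ κ (τ j) ≤ (1 - τ j) ^ κ (τ j) :=
        pow_le_pow_left₀ h0 (by linarith [hanti hij]) _
      rw [sub_zero, abs_of_nonneg (pow_nonneg h0 _)]
      linarith

end Sequences

/-! ### Projections onto closed spans, and their iterates. -/

section Projections

variable {𝕜 : Type*} [RCLike 𝕜] {H : Type*} [NormedAddCommGroup H] [InnerProductSpace 𝕜 H]

/-- The closed span of a set. -/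
def closedSpan (𝕜 : Type*) [RCLike 𝕜] {H : Type*} [NormedAddCommGroup H] [InnerProductSpace 𝕜 H]
    (S : Set H) : ClosedSubmodule 𝕜 H :=
  ⟨(Submodule.span 𝕜 S).topologicalClosure, Submodule.isClosed_topologicalClosure _⟩

theorem subset_closedSpan (S : Set H) : S ⊆ (closedSpan 𝕜 S).toSubmodule := fun _ hx =>
  Submodule.le_topologicalClosure _ (Submodule.subset_span hx)

theorem closedSpan_le {S : Set H} {L : ClosedSubmodule 𝕜 H} (h : ∀ x ∈ S, x ∈ L) :
    closedSpan 𝕜 S ≤ L :=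
  Submodule.topologicalClosure_minimal _ (Submodule.span_le.2 h) L.isClosed

theorem mem_orthogonal_closedSpan {S : Set H} {x : H} (h : ∀ s ∈ S, inner 𝕜 s x = 0) :
    x ∈ (closedSpan 𝕜 S).toSubmoduleᗮ := by
  rw [closedSpan, Submodule.orthogonal_closure, Submodule.mem_orthogonal]
  intro u hu
  induction hu using Submodule.span_induction with
  | mem s hs => exact h s hs
  | zero => simp
  | add a b _ _ ha hb => rw [inner_add_left, ha, hb, add_zero]
  | smul c a _ ha => rw [inner_smul_left, ha, mul_zero]

variable [CompleteSpace H]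

theorem starProjection_closedSpan_eq {S : Set H} {x y : H} (hy : y ∈ (closedSpan 𝕜 S).toSubmodule)
    (h : ∀ s ∈ S, inner 𝕜 s (x - y) = 0) : (closedSpan 𝕜 S).toSubmodule.starProjection x = y :=
  (Submodule.eq_starProjection_of_mem_orthogonal hy (mem_orthogonal_closedSpan h))

theorem norm_starProjection_sub_le (M : ClosedSubmodule 𝕜 H) (x y : H) :
    ‖M.toSubmodule.starProjection x - M.toSubmodule.starProjection y‖ ≤ ‖x - y‖ := by
  rw [← map_sub]
  exact Submodule.norm_starProjection_apply_le _ _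

theorem norm_starProjection_sub_self_le (M : ClosedSubmodule 𝕜 H) (x : H) {y : H} (hy : y ∈ M) :
    ‖M.toSubmodule.starProjection x - x‖ ≤ ‖x - y‖ := by
  rw [norm_sub_rev, Submodule.starProjection_minimal]
  exact ciInf_le ⟨0, by rintro _ ⟨_, rfl⟩; positivity⟩ (⟨y, hy⟩ : M.toSubmodule)

theorem infDist_eq_norm_sub_starProjection (M : ClosedSubmodule 𝕜 H) (x : H) :
    Metric.infDist x (M : Set H) = ‖x - M.toSubmodule.starProjection x‖ := by
  apply le_antisymm
  · rw [← dist_eq_norm]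
    exact Metric.infDist_le_dist_of_mem (Submodule.starProjection_apply_mem _ _)
  · refine (Metric.le_infDist ⟨0, M.zero_mem⟩).2 fun y hy => ?_
    rw [dist_eq_norm, norm_sub_rev]
    exact norm_starProjection_sub_self_le M x hy

/-- Iterated projections along an initial segment of the index sequence. -/
theorem projIterates_add_length {ι : Type*} (M : ι → ClosedSubmodule 𝕜 H) (k : ℕ → ι) (z₀ : H)
    (t : ℕ) (w : List ι) (hw : ∀ i (hi : i < w.length), k (t + i) = w[i]) :
    projIterates M k z₀ (t + w.length) =
      w.foldl (fun z i => (M i).toSubmodule.starProjection z) (projIterates M k z₀ t) := by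
  induction w generalizing t with
  | nil => simp
  | cons l w ih =>
    have h0 : k t = l := hw 0 (by simp)
    have := ih (t + 1) fun i hi => by
      have := hw (i + 1) (by simpa using hi)
      rw [add_assoc, add_comm 1 i]; simpa using this
    rw [List.foldl_cons, List.length_cons, add_comm w.length 1, ← add_assoc, this]
    simp [projIterates, h0]

end Projections

/-! ### Orthogonal families of nearly equal vectors in the subspaces. -/

section Vectors

variable {𝕜 : Type*} [RCLike 𝕜] {H : Type*} [NormedAddCommGroup H] [InnerProductSpace 𝕜 H]

/-- A finite-rank projection maps weakly null sequences to norm null sequences. -/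
theorem tendsto_starProjection_zero (G : Submodule 𝕜 H) [FiniteDimensional 𝕜 G] {w : ℕ → H}
    (hw : ∀ y, Tendsto (fun n => inner 𝕜 y (w n)) atTop (𝓝 0)) :
    Tendsto (fun n => G.starProjection (w n)) atTop (𝓝 0) := by
  let b := stdOrthonormalBasis 𝕜 G
  have h : ∀ n, G.starProjection (w n) = ∑ i, inner 𝕜 (b i : H) (w n) • (b i : H) := fun n => by
    rw [Submodule.starProjection_apply, b.orthogonalProjectionOnto_apply_eq_sum]
    simp
  simp only [h]
  have := tendsto_finsetSum (Finset.univ : Finset (Fin (Module.finrank 𝕜 G)))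
    fun i _ => (hw (b i : H)).smul_const (b i : H)
  simpa using this

/-- Unit vectors in the `L k`, nearly equal to one another and orthogonal to a given
finite-dimensional subspace. -/
theorem exists_close_unit_vectors {K : ℕ} [CompleteSpace H] (L : Fin K → ClosedSubmodule 𝕜 H) {w : ℕ → H}
    (hw1 : ∀ n, ‖w n‖ = 1) (hw : ∀ y, Tendsto (fun n => inner 𝕜 y (w n)) atTop (𝓝 0))
    (hd : ∀ k, Tendsto (fun n => ‖w n - (L k).toSubmodule.starProjection (w n)‖) atTop (𝓝 0))
    (G : Submodule 𝕜 H) [FiniteDimensional 𝕜 G] {δ : ℝ} (hδ : 0 < δ) :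
    ∃ g : Fin K → H, (∀ k, g k ∈ L k) ∧ (∀ k, ‖g k‖ = 1) ∧ (∀ k, g k ∈ Gᗮ) ∧
      ∀ k l, ‖g k - g l‖ ≤ δ := by
  -- Removing the part in `P(L k) G` instead of the part in `G` keeps the vector in `L k`;
  -- orthogonality to `G` follows by moving `P(L k)` across the inner product.
  let G' : Fin K → Submodule 𝕜 H := fun k => G.map ((L k).toSubmodule.starProjection : H →ₗ[𝕜] H)
  have hG' : ∀ k, G' k ≤ (L k).toSubmodule := by
    rintro k _ ⟨x, -, rfl⟩
    exact Submodule.starProjection_apply_mem _ _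
  let v : Fin K → ℕ → H := fun k n =>
    (L k).toSubmodule.starProjection (w n) - (G' k).starProjection (w n)
  have hvL : ∀ k n, v k n ∈ L k := fun k n =>
    (L k).toSubmodule.sub_mem (Submodule.starProjection_apply_mem _ _)
      (hG' k (Submodule.starProjection_apply_mem _ _))
  have hvG : ∀ k n, v k n ∈ Gᗮ := by
    intro k n
    rw [Submodule.mem_orthogonal]
    intro g hg
    have h1 : inner 𝕜 ((L k).toSubmodule.starProjection g)
        (w n - (G' k).starProjection (w n)) = 0 :=
      Submodule.inner_right_of_mem_orthogonal (K := G' k) ⟨g, hg, rfl⟩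
        (Submodule.sub_starProjection_mem_orthogonal _)
    have h2 : (L k).toSubmodule.starProjection ((G' k).starProjection (w n))
        = (G' k).starProjection (w n) :=
      Submodule.starProjection_eq_self_iff.2 (hG' k (Submodule.starProjection_apply_mem _ _))
    rw [Submodule.inner_starProjection_left_eq_right, map_sub, h2] at h1
    exact h1
  have hvw : ∀ k, Tendsto (fun n => ‖v k n - w n‖) atTop (𝓝 0) := by
    intro k
    have h := (hd k).add (tendsto_starProjection_zero (G' k) hw).norm
    simp only [norm_zero, add_zero] at h
    refine squeeze_zero (fun _ => norm_nonneg _) (fun n => ?_) h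
    have : v k n - w n = -((w n - (L k).toSubmodule.starProjection (w n))
        + (G' k).starProjection (w n)) := by simp only [v]; abel
    rw [this, norm_neg]
    exact norm_add_le _ _
  have hev : ∀ᶠ n in atTop, ∀ k, ‖v k n - w n‖ < min (δ / 4) 1 :=
    eventually_all.2 fun k => (hvw k).eventually (gt_mem_nhds (by positivity))
  obtain ⟨n, hn⟩ := hev.exists
  clear_value v
  have hpos : ∀ k, 0 < ‖v k n‖ := fun k => by
    have h1 := norm_sub_norm_le (w n) (v k n)
    rw [norm_sub_rev, hw1] at h1
    linarith [(hn k).trans_le (min_le_right _ _)]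
  have hclose : ∀ k, ‖((‖v k n‖⁻¹ : ℝ) : 𝕜) • v k n - w n‖ ≤ δ / 2 := by
    intro k
    have h1 : ‖((‖v k n‖⁻¹ : ℝ) : 𝕜) • v k n - v k n‖ = |1 - ‖v k n‖| := by
      have h3 : ((‖v k n‖⁻¹ : ℝ) : 𝕜) • v k n - v k n
          = (((‖v k n‖⁻¹ - 1 : ℝ)) : 𝕜) • v k n := by
        push_cast; rw [sub_smul, one_smul]
      rw [h3, norm_smul, RCLike.norm_ofReal, ← abs_of_pos (hpos k), ← abs_mul,
        abs_of_pos (hpos k), sub_mul, inv_mul_cancel₀ (hpos k).ne', one_mul]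
    have h2 := abs_norm_sub_norm_le (w n) (v k n)
    rw [hw1, norm_sub_rev] at h2
    have h4 := norm_sub_le_norm_sub_add_norm_sub (((‖v k n‖⁻¹ : ℝ) : 𝕜) • v k n) (v k n) (w n)
    linarith [(hn k).trans_le (min_le_left _ _)]
  refine ⟨fun k => ((‖v k n‖⁻¹ : ℝ) : 𝕜) • v k n, fun k => ?_, fun k => ?_, fun k => ?_, ?_⟩
  · exact (L k).toSubmodule.smul_mem _ (hvL k n)
  · rw [norm_smul, RCLike.norm_ofReal, abs_of_pos (inv_pos.2 (hpos k)),
      inv_mul_cancel₀ (hpos k).ne']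
  · exact Submodule.smul_mem _ _ (hvG k n)
  · intro k l
    have h := norm_sub_le_norm_sub_add_norm_sub (((‖v k n‖⁻¹ : ℝ) : 𝕜) • v k n) (w n)
      (((‖v l n‖⁻¹ : ℝ) : 𝕜) • v l n)
    rw [norm_sub_rev (w n)] at h
    linarith [hclose k, hclose l]

/-- A family of nearly equal unit vectors in the `L k` for every index in a countable set,
orthogonal for different indices. -/
theorem exists_orthogonal_close_vectors {K : ℕ} (L : Fin K → ClosedSubmodule 𝕜 H)
    (h : ∀ (G : Submodule 𝕜 H) [FiniteDimensional 𝕜 G] (δ : ℝ), 0 < δ →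
      ∃ g : Fin K → H, (∀ k, g k ∈ L k) ∧ (∀ k, ‖g k‖ = 1) ∧ (∀ k, g k ∈ Gᗮ) ∧
        ∀ k l, ‖g k - g l‖ ≤ δ)
    {I : Type*} [Countable I] (δ : I → ℝ) (hδ : ∀ i, 0 < δ i) :
    ∃ f : I → Fin K → H, (∀ i k, f i k ∈ L k) ∧ (∀ i k, ‖f i k‖ = 1) ∧
      (∀ i j k l, i ≠ j → inner 𝕜 (f i k) (f j l) = 0) ∧ ∀ i k l, ‖f i k - f i l‖ ≤ δ i := by
  classical
  obtain ⟨enc, henc⟩ := exists_injective_nat I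
  let P : I × (Fin K → H) → Prop := fun y => (∀ k, y.2 k ∈ L k) ∧ (∀ k, ‖y.2 k‖ = 1) ∧
    ∀ k l, ‖y.2 k - y.2 l‖ ≤ δ y.1
  have step : ∀ (i : I) (s : Finset (Fin K → H)), ∃ g : Fin K → H, P (i, g) ∧
      ∀ x ∈ s, ∀ k l, inner 𝕜 (x k) (g l) = 0 := by
    intro i s
    let G : Submodule 𝕜 H := Submodule.span 𝕜 (⋃ x ∈ s, Set.range x)
    have : FiniteDimensional 𝕜 G := FiniteDimensional.span_of_finite 𝕜
      (Set.Finite.biUnion s.finite_toSet fun x _ => Set.finite_range x)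
    obtain ⟨g, h1, h2, h3, h4⟩ := h G (δ i) (hδ i)
    refine ⟨g, ⟨h1, h2, h4⟩, fun x hx k l => ?_⟩
    have hxG : x k ∈ G := Submodule.subset_span (Set.mem_biUnion hx ⟨k, rfl⟩)
    exact Submodule.inner_right_of_mem_orthogonal hxG (h3 l)
  choose g hg1 hg2 using step
  rcases isEmpty_or_nonempty I with hI | hI
  · exact ⟨fun i => isEmptyElim i, fun i => isEmptyElim i, fun i => isEmptyElim i,
      fun i => isEmptyElim i, fun i => isEmptyElim i⟩
  let dec : ℕ → I := Function.invFun enc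
  have hdec : ∀ i, dec (enc i) = i := Function.leftInverse_invFun henc
  -- Greedy choice along an enumeration: `A n` holds the families chosen before stage `n`, to which
  -- the next one is made orthogonal.
  let A : ℕ → Finset (Fin K → H) := fun n => Nat.rec ∅ (fun m s => insert (g (dec m) s) s) n
  have hA : ∀ n, A (n + 1) = insert (g (dec n) (A n)) (A n) := fun n => rfl
  have hAmono : Monotone A := monotone_nat_of_le_succ fun n => by
    rw [hA]; exact Finset.subset_insert _ _
  have key : ∀ m n, m < n → ∀ k l, inner 𝕜 (g (dec m) (A m) k) (g (dec n) (A n) l) = 0 := by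
    intro m n hmn
    refine hg2 _ _ _ (hAmono (Nat.succ_le_of_lt hmn) ?_)
    rw [Nat.succ_eq_add_one, hA]
    exact Finset.mem_insert_self _ _
  refine ⟨fun i => g i (A (enc i)), fun i => (hg1 _ _).1, fun i => (hg1 _ _).2.1, ?_,
    fun i => (hg1 _ _).2.2⟩
  intro i j k l hij
  rcases lt_or_gt_of_ne (henc.ne hij) with hlt | hlt
  · have := key _ _ hlt k l
    rwa [hdec, hdec] at this
  · have := key _ _ hlt l k
    rw [hdec, hdec] at this
    exact inner_eq_zero_symm.1 this

end Vectors

/-! ### From a non-closed sum of complements to a weakly null sequence. -/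

section NotClosed

variable {𝕜 : Type*} [RCLike 𝕜] {H : Type*} [NormedAddCommGroup H] [InnerProductSpace 𝕜 H]
  [CompleteSpace H]

theorem sum_submodule_eq_iSup {R M ι : Type*} [Semiring R] [AddCommMonoid M] [Module R M]
    [Fintype ι] (N : ι → Submodule R M) : ∑ k, N k = ⨆ k, N k := by
  classical
  have h : ∀ s : Finset ι, ∑ k ∈ s, N k = s.sup N := fun s => by
    induction s using Finset.induction_on with
    | empty => rfl
    | insert a s ha ih => rw [Finset.sum_insert ha, ih, Finset.sup_insert, Submodule.add_eq_sup]
  rw [h, Finset.sup_univ_eq_iSup]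

/-- If `∑ k, ‖Q k y‖ ^ 2` is bounded below on the closure of the sum of the ranges of the orthogonal
projections `Q k`, then this sum is closed. -/
theorem isClosed_sum_of_bounded_below {K : ℕ} (N : Fin K → Submodule 𝕜 H)
    [∀ k, (N k).HasOrthogonalProjection] {c : ℝ} (hc : 0 < c)
    (h : ∀ y ∈ (∑ k, N k).topologicalClosure, c * ‖y‖ ^ 2 ≤ ∑ k, ‖(N k).starProjection y‖ ^ 2) :
    IsClosed ((∑ k, N k : Submodule 𝕜 H) : Set H) := by
  set R := (∑ k, N k).topologicalClosure with hR
  have hRc : IsClosed (R : Set H) := Submodule.isClosed_topologicalClosure _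
  have : CompleteSpace R := hRc.completeSpace_coe
  have hsum : ∑ k, N k = ⨆ k, N k := sum_submodule_eq_iSup N
  have hNR : ∀ k, N k ≤ R := fun k =>
    le_trans (hsum ▸ le_iSup N k) (Submodule.le_topologicalClosure _)
  let A : H →L[𝕜] H := ∑ k, (N k).starProjection
  have hA : ∀ y, A y = ∑ k, (N k).starProjection y := fun y => by simp [A]
  have hAR : ∀ y, A y ∈ R := fun y => by
    rw [hA]
    exact R.sum_mem fun k _ => hNR k (Submodule.starProjection_apply_mem _ _)
  let A' : R →L[𝕜] R := (A.comp R.subtypeL).codRestrict R fun y => hAR y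
  have hcoer : ∀ y : R, ‖y‖ ^ 2 * c ≤ ‖inner 𝕜 (A' y) y‖ := by
    intro y
    rw [mul_comm]
    refine (h y y.2).trans (le_trans (le_of_eq ?_) (RCLike.re_le_norm _))
    have : inner 𝕜 (A' y) y = inner 𝕜 (A y) (y : H) := rfl
    rw [this, hA, sum_inner, map_sum]
    refine Finset.sum_congr rfl fun k _ => ?_
    rw [Submodule.re_inner_starProjection_eq_normSq, Submodule.starProjection_apply,
      Submodule.coe_norm]
  -- By coercivity (Lax–Milgram) the restriction of `A` to `R` is invertible, so `R` lies in the
  -- range of `A`, which lies in the sum.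
  have hunit := ContinuousLinearMap.isUnit_of_forall_le_norm_inner_map A' (c := ⟨c, hc.le⟩) hc hcoer
  rw [ContinuousLinearMap.isUnit_iff_bijective] at hunit
  have hle : R ≤ ∑ k, N k := by
    intro x hx
    obtain ⟨y, hy⟩ := hunit.2 ⟨x, hx⟩
    have : x = A y := congrArg Subtype.val hy.symm
    rw [this, hA, hsum]
    exact Submodule.sum_mem_iSup fun k => Submodule.starProjection_apply_mem _ _
  have : R = ∑ k, N k := le_antisymm hle (Submodule.le_topologicalClosure _)
  rw [← this]
  exact hRc

/-- If the sum of the `(L k)ᗮ` is not closed, there is a weakly null sequence of unit vectors whose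
distance to every `L k` tends to zero. -/
theorem exists_weakly_null_of_not_isClosed {K : ℕ} (L : Fin K → ClosedSubmodule 𝕜 H)
    (h : ¬ IsClosed ((∑ k : Fin K, (L k).toSubmoduleᗮ : Submodule 𝕜 H) : Set H)) :
    ∃ w : ℕ → H, (∀ n, ‖w n‖ = 1) ∧ (∀ y, Tendsto (fun n => inner 𝕜 y (w n)) atTop (𝓝 0)) ∧
      ∀ k, Tendsto (fun n => ‖w n - (L k).toSubmodule.starProjection (w n)‖) atTop (𝓝 0) := by
  let N : Fin K → Submodule 𝕜 H := fun k => (L k).toSubmoduleᗮ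
  set R := (∑ k, N k).topologicalClosure with hR
  have hex : ∀ n : ℕ, ∃ y ∈ R, ‖y‖ = 1 ∧ ∑ k, ‖(N k).starProjection y‖ ^ 2 ≤ 1 / ((n : ℝ) + 1) := by
    intro n
    have hn : (0 : ℝ) < 1 / ((n : ℝ) + 1) := by positivity
    by_contra! hcon
    refine h (isClosed_sum_of_bounded_below N hn fun y hy => ?_)
    rcases eq_or_ne y 0 with rfl | hy0
    · simp
    have hpos : 0 < ‖y‖ := norm_pos_iff.2 hy0
    have h1 := hcon (((‖y‖⁻¹ : ℝ) : 𝕜) • y) (R.smul_mem _ hy)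
      (by rw [norm_smul, RCLike.norm_ofReal, abs_of_pos (inv_pos.2 hpos),
        inv_mul_cancel₀ hpos.ne'])
    simp only [map_smul, norm_smul, RCLike.norm_ofReal, mul_pow, ← Finset.mul_sum, sq_abs] at h1
    have h2 := mul_lt_mul_of_pos_right h1 (pow_pos hpos 2)
    have h3 : ‖y‖⁻¹ ^ 2 * (∑ k, ‖(N k).starProjection y‖ ^ 2) * ‖y‖ ^ 2
        = ∑ k, ‖(N k).starProjection y‖ ^ 2 := by
      field_simp
    rw [h3] at h2
    exact h2.le
  choose w hwR hw1 hwN using hex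
  have hdist : ∀ k, Tendsto (fun n => ‖(N k).starProjection (w n)‖) atTop (𝓝 0) := by
    intro k
    have h0 : Tendsto (fun n : ℕ => Real.sqrt (1 / ((n : ℝ) + 1))) atTop (𝓝 0) := by
      have := (Real.continuous_sqrt.tendsto 0).comp tendsto_one_div_add_atTop_nhds_zero_nat
      rwa [Real.sqrt_zero] at this
    refine squeeze_zero (fun _ => norm_nonneg _) (fun n => ?_) h0
    refine Real.le_sqrt_of_sq_le (le_trans ?_ (hwN n))
    exact Finset.single_le_sum (f := fun k => ‖(N k).starProjection (w n)‖ ^ 2)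
      (fun _ _ => sq_nonneg _) (Finset.mem_univ k)
  have hsum : ∑ k, N k = ⨆ k, N k := sum_submodule_eq_iSup N
  refine ⟨w, hw1, ?_, fun k => ?_⟩
  · have hdense : ∀ y ∈ ⨆ k, N k, Tendsto (fun n => inner 𝕜 y (w n)) atTop (𝓝 0) := by
      intro y hy
      induction hy using Submodule.iSup_induction' with
      | mem k x hx =>
        have h1 : ∀ n, inner 𝕜 x (w n) = inner 𝕜 x ((N k).starProjection (w n)) := fun n => by
          rw [← Submodule.inner_starProjection_left_eq_right,
            Submodule.starProjection_eq_self_iff.2 hx]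
        simp only [h1]
        refine squeeze_zero_norm (fun n => norm_inner_le_norm _ _) ?_
        simpa using (hdist k).const_mul ‖x‖
      | zero => simp
      | add a b _ _ ha hb => simpa [inner_add_left] using ha.add hb
    intro y
    have : CompleteSpace R := (Submodule.isClosed_topologicalClosure _).completeSpace_coe
    -- As `w n ∈ R`, only the component of `y` in `R` counts, and it is a norm limit of vectors of
    -- the sum.
    have h1 : ∀ n, inner 𝕜 y (w n) = inner 𝕜 (R.starProjection y) (w n) := fun n => by
      rw [Submodule.inner_starProjection_left_eq_right,
        Submodule.starProjection_eq_self_iff.2 (hwR n)]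
    simp only [h1]
    have hmem : R.starProjection y ∈ closure ((∑ k, N k : Submodule 𝕜 H) : Set H) :=
      Submodule.starProjection_apply_mem R y
    rw [Metric.tendsto_atTop]
    intro ε hε
    obtain ⟨x, hx, hxy⟩ := Metric.mem_closure_iff.1 hmem (ε / 2) (half_pos hε)
    obtain ⟨n₀, hn₀⟩ := Metric.tendsto_atTop.1 (hdense x (hsum ▸ hx)) (ε / 2) (half_pos hε)
    refine ⟨n₀, fun n hn => ?_⟩
    have h2 := hn₀ n hn
    rw [dist_zero_right] at h2 ⊢
    have h3 : inner 𝕜 (R.starProjection y) (w n)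
        = inner 𝕜 (R.starProjection y - x) (w n) + inner 𝕜 x (w n) := by
      rw [inner_sub_left, sub_add_cancel]
    have h4 := norm_inner_le_norm (𝕜 := 𝕜) (R.starProjection y - x) (w n)
    rw [hw1, mul_one, ← dist_eq_norm] at h4
    rw [h3]
    linarith [norm_add_le (inner 𝕜 (R.starProjection y - x) (w n)) (inner 𝕜 x (w n))]
  · refine (hdist k).congr fun n => ?_
    rw [Submodule.starProjection_orthogonal_val]

end NotClosed

/-! ### Diagonal operators on a finite-dimensional space. -/

section DiagonalOperators

variable {𝕜 : Type*} [RCLike 𝕜] {ι : Type*} [Fintype ι] [DecidableEq ι]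

/-- The diagonal operator with real entries `φ`. -/
noncomputable def diagOp (𝕜 : Type*) [RCLike 𝕜] {ι : Type*} [Fintype ι] [DecidableEq ι] (φ : ι → ℝ) :
    EuclideanSpace 𝕜 ι →L[𝕜] EuclideanSpace 𝕜 ι :=
  Matrix.toEuclideanCLM (n := ι) (𝕜 := 𝕜) (Matrix.diagonal fun i => (φ i : 𝕜))

theorem diagOp_apply (φ : ι → ℝ) (x : EuclideanSpace 𝕜 ι) (i : ι) :
    diagOp 𝕜 φ x i = (φ i : 𝕜) * x i := by
  simp [diagOp, Matrix.mulVec_diagonal]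

theorem diagOp_mul (φ ψ : ι → ℝ) : diagOp 𝕜 φ * diagOp 𝕜 ψ = diagOp 𝕜 (φ * ψ) := by
  ext x i
  simp [diagOp_apply, mul_assoc]

theorem diagOp_one : diagOp 𝕜 (1 : ι → ℝ) = 1 := by
  ext x i
  simp [diagOp_apply]

theorem diagOp_sub (φ ψ : ι → ℝ) : diagOp 𝕜 φ - diagOp 𝕜 ψ = diagOp 𝕜 (φ - ψ) := by
  ext x i
  simp [diagOp_apply, sub_mul]

theorem diagOp_add (φ ψ : ι → ℝ) : diagOp 𝕜 φ + diagOp 𝕜 ψ = diagOp 𝕜 (φ + ψ) := by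
  ext x i
  simp [diagOp_apply, add_mul]

theorem star_diagOp (φ : ι → ℝ) : star (diagOp 𝕜 φ) = diagOp 𝕜 φ := by
  rw [diagOp, ← map_star, Matrix.star_eq_conjTranspose, Matrix.diagonal_conjTranspose]
  congr 2
  ext i
  simp

theorem norm_diagOp_le (φ : ι → ℝ) {C : ℝ} (hC : 0 ≤ C) (h : ∀ i, |φ i| ≤ C) :
    ‖diagOp 𝕜 φ‖ ≤ C := by
  rw [diagOp, Matrix.l2_opNorm_toEuclideanCLM, Matrix.l2_opNorm_diagonal]
  exact (pi_norm_le_iff_of_nonneg hC).2 fun i => by simpa using h i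

end DiagonalOperators

/-! ### Rotations of a plane. -/

section Rotation

open InnerProductSpace

variable {𝕜 : Type*} [RCLike 𝕜] {E : Type*} [NormedAddCommGroup E] [InnerProductSpace 𝕜 E]

/-- The rotation by the angle `t` in the plane of the orthonormal vectors `p` and `a`. -/
noncomputable def planeRotation (𝕜 : Type*) [RCLike 𝕜] {E : Type*} [NormedAddCommGroup E]
    [InnerProductSpace 𝕜 E] (p a : E) (t : ℝ) : E →L[𝕜] E :=
  1 + ((Real.cos t - 1 : ℝ) : 𝕜) • (rankOne 𝕜 p p + rankOne 𝕜 a a)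
    + ((Real.sin t : ℝ) : 𝕜) • (rankOne 𝕜 p a - rankOne 𝕜 a p)

theorem planeRotation_zero (p a : E) : planeRotation 𝕜 p a 0 = 1 := by
  simp [planeRotation]

theorem star_planeRotation [CompleteSpace E] (p a : E) (t : ℝ) :
    star (planeRotation 𝕜 p a t) = planeRotation 𝕜 p a (-t) := by
  have h : ∀ x y : E, star (rankOne 𝕜 x y) = rankOne 𝕜 y x := fun x y => by
    rw [ContinuousLinearMap.star_eq_adjoint, adjoint_rankOne]
  simp only [planeRotation, star_add, star_smul, star_sub, h, star_one, Real.cos_neg, Real.sin_neg,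
    RCLike.star_def, RCLike.conj_ofReal]
  push_cast
  module

theorem continuous_planeRotation (p a : E) : Continuous (planeRotation 𝕜 p a) := by
  unfold planeRotation
  have h1 : Continuous fun t : ℝ => ((Real.cos t - 1 : ℝ) : 𝕜) :=
    RCLike.continuous_ofReal.comp (Real.continuous_cos.sub continuous_const)
  have h2 : Continuous fun t : ℝ => ((Real.sin t : ℝ) : 𝕜) :=
    RCLike.continuous_ofReal.comp Real.continuous_sin
  exact (continuous_const.add (h1.smul continuous_const)).add (h2.smul continuous_const)

theorem planeRotation_mul_neg {p a : E} (hp : ‖p‖ = 1) (ha : ‖a‖ = 1) (hpa : inner 𝕜 p a = 0)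
    (t : ℝ) : planeRotation 𝕜 p a t * planeRotation 𝕜 p a (-t) = 1 := by
  have hap : inner 𝕜 a p = 0 := inner_eq_zero_symm.1 hpa
  have hpp : inner 𝕜 p p = 1 := by simp [inner_self_eq_norm_sq_to_K, hp]
  have haa : inner 𝕜 a a = 1 := by simp [inner_self_eq_norm_sq_to_K, ha]
  have hcs : (Real.cos t : 𝕜) ^ 2 + (Real.sin t : 𝕜) ^ 2 = 1 := by
    have := Real.cos_sq_add_sin_sq t
    exact_mod_cast this
  ext x
  simp only [planeRotation, mul_apply_eq_comp, add_apply, smul_apply, sub_apply,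
    one_apply_eq_self, rankOne_apply, Real.cos_neg, Real.sin_neg, inner_add_right,
    inner_sub_right, inner_smul_right, hpa, hap, hpp, haa]
  push_cast
  match_scalars
  · ring
  · linear_combination inner 𝕜 p x * hcs
  · linear_combination inner 𝕜 a x * hcs

theorem planeRotation_mem_unitary [CompleteSpace E] {p a : E} (hp : ‖p‖ = 1) (ha : ‖a‖ = 1)
    (hpa : inner 𝕜 p a = 0) (t : ℝ) : planeRotation 𝕜 p a t ∈ unitary (E →L[𝕜] E) := by
  rw [Unitary.mem_iff, star_planeRotation]
  refine ⟨?_, planeRotation_mul_neg hp ha hpa t⟩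
  have := planeRotation_mul_neg hp ha hpa (-t)
  rwa [neg_neg] at this

/-- A self-adjoint operator that fixes `p` and `a` commutes with every rank-one operator built from
them. Later tilts thus leave the lower members of the chain untouched. -/
theorem commute_planeRotation [CompleteSpace E] {p a : E} {Z : E →L[𝕜] E} (hZ : star Z = Z)
    (hp : Z p = p) (ha : Z a = a) (t : ℝ) : Commute (planeRotation 𝕜 p a t) Z := by
  have h : ∀ x y : E, Z x = x → Z y = y → Commute (rankOne 𝕜 x y) Z := fun x y hx hy => by
    rw [commute_iff_eq, ContinuousLinearMap.mul_def, ContinuousLinearMap.mul_def, rankOne_comp,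
      comp_rankOne, ← ContinuousLinearMap.star_eq_adjoint, hZ, hx, hy]
  unfold planeRotation
  exact ((Commute.one_left Z).add_left (((h p p hp hp).add_left (h a a ha ha)).smul_left _)).add_left
    (((h p a hp ha).sub_left (h a p ha hp)).smul_left _)

/-- Compressing the rotated projection `R Z R*` shrinks `p` by `cos² t`. -/
theorem compression_planeRotation {p a : E} (hp : ‖p‖ = 1)
    (hpa : inner 𝕜 p a = 0) {X Z : E →L[𝕜] E} (hXp : X p = p) (hXa : X a = 0) (hZp : Z p = p)
    (hZa : Z a = 0) (t : ℝ) :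
    X (planeRotation 𝕜 p a t (Z (planeRotation 𝕜 p a (-t) p)))
      = ((Real.cos t ^ 2 : ℝ) : 𝕜) • p := by
  have hap : inner 𝕜 a p = 0 := inner_eq_zero_symm.1 hpa
  have hpp : inner 𝕜 p p = 1 := by simp [inner_self_eq_norm_sq_to_K, hp]
  have h1 : ∀ s, planeRotation 𝕜 p a s p
      = ((Real.cos s : ℝ) : 𝕜) • p - ((Real.sin s : ℝ) : 𝕜) • a := by
    intro s
    simp only [planeRotation, add_apply, smul_apply, sub_apply,
      one_apply_eq_self, rankOne_apply, hap, hpp]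
    push_cast
    module
  rw [h1, map_sub, map_smul, map_smul, hZp, hZa, smul_zero, sub_zero, map_smul, h1, map_smul,
    map_sub, map_smul, map_smul, hXp, hXa, smul_zero, sub_zero, smul_smul, Real.cos_neg]
  push_cast
  rw [sq]

theorem planeRotation_apply_of_orthogonal {p a u : E} (hpu : inner 𝕜 p u = 0)
    (hau : inner 𝕜 a u = 0) (t : ℝ) : planeRotation 𝕜 p a t u = u := by
  simp [planeRotation, hpu, hau]

end Rotation

/-! ### Line projections as limits of words in a plane projection and a tilted chain. -/

section Spokes

open InnerProductSpace

theorem norm_list_prod_le_one {R : Type*} [NormedRing R] [NormOneClass R] (l : List R)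
    (h : ∀ a ∈ l, ‖a‖ ≤ 1) : ‖l.prod‖ ≤ 1 := by
  induction l with
  | nil => simp
  | cons a l ih =>
    rw [List.prod_cons]
    exact (norm_mul_le _ _).trans (mul_le_one₀ (h a List.mem_cons_self) (norm_nonneg _)
      (ih fun b hb => h b (List.mem_cons_of_mem _ hb)))

variable {𝕜 : Type*} [RCLike 𝕜] {E : Type*} [NormedAddCommGroup E] [InnerProductSpace 𝕜 E]
  [CompleteSpace E]

/-- The letters: `none` stands for `X`, and `some j` for the conjugate of `Z j` by `U`. -/
noncomputable def letterOp (X : E →L[𝕜] E) (Z : ℕ → E →L[𝕜] E) (U : E →L[𝕜] E) : Option ℕ → E →L[𝕜] E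
  | none => X
  | some j => U * Z j * star U

/-- Products `X * Q (N - 1) * ⋯ * Q (N - m)`. -/
noncomputable def spokeProduct (X : E →L[𝕜] E) (Q : ℕ → E →L[𝕜] E) (N : ℕ) : ℕ → E →L[𝕜] E
  | 0 => X
  | m + 1 => spokeProduct X Q N m * Q (N - (m + 1))

theorem norm_letterOp_le {X : E →L[𝕜] E} {Z : ℕ → E →L[𝕜] E} {U : E →L[𝕜] E} (hX : ‖X‖ ≤ 1)
    (hZ : ∀ j, ‖Z j‖ ≤ 1) (hU : U ∈ unitary (E →L[𝕜] E)) (l : Option ℕ) :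
    ‖letterOp X Z U l‖ ≤ 1 := by
  cases l with
  | none => exact hX
  | some j =>
    have h : letterOp X Z U (some j) = U * Z j * star U := rfl
    rw [h, CStarRing.norm_mul_mem_unitary _ (Unitary.star_mem hU),
      CStarRing.norm_mem_unitary_mul _ hU]
    exact hZ j

/-- Products of projections onto lines of the range of `X` are approximated by words in `X` and in
the projections of a decreasing chain. -/
theorem exists_word_near_spokeProduct [Nontrivial E] {N : ℕ} {X : E →L[𝕜] E} {Z : ℕ → E →L[𝕜] E}
    {u p a : ℕ → E}
    (hX1 : ‖X‖ ≤ 1) (hZ1 : ∀ j, ‖Z j‖ ≤ 1) (hZs : ∀ j, star (Z j) = Z j)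
    (hX : ∀ j, X = rankOne 𝕜 (u j) (u j) + rankOne 𝕜 (p j) (p j))
    (hu : ∀ j, ‖u j‖ = 1) (hp : ∀ j, ‖p j‖ = 1) (hup : ∀ j, inner 𝕜 (p j) (u j) = 0)
    (ha : ∀ j < N, ‖a j‖ = 1) (hpa : ∀ i, ∀ j < N, inner 𝕜 (p i) (a j) = 0)
    (hua : ∀ i, ∀ j < N, inner 𝕜 (u i) (a j) = 0)
    (hZu : ∀ i, ∀ j ≤ N, Z j (u i) = u i) (hZp : ∀ i, ∀ j ≤ N, Z j (p i) = p i)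
    (hZa : ∀ i < N, ∀ j, Z j (a i) = if j ≤ i then a i else 0) (m : ℕ) (hm : m ≤ N) {ε : ℝ}
    (hε : 0 < ε) :
    ∃ U ∈ unitary (E →L[𝕜] E), ∃ w : List (Option ℕ), (∀ i ≤ N - m, Commute U (Z i)) ∧
      ‖(w.map (letterOp X Z U)).prod * X
        - spokeProduct X (fun j => rankOne 𝕜 (u j) (u j)) N m‖ < ε := by
  induction m generalizing ε with
  | zero =>
    refine ⟨1, one_mem _, [], fun i _ => Commute.one_left _, ?_⟩
    simpa [spokeProduct] using hε
  | succ m ih =>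
    obtain ⟨U, hU, w, hcomm, hw⟩ := ih (by omega) (half_pos hε)
    obtain ⟨j, hj⟩ : ∃ j, j = N - (m + 1) := ⟨_, rfl⟩
    have hjN : j < N := by omega
    have hj1 : N - m = j + 1 := by omega
    rw [hj1] at hcomm
    have hpu : inner 𝕜 (u j) (p j) = 0 := inner_eq_zero_symm.1 (hup j)
    have hXu : X (u j) = u j := by rw [hX j]; simp [hu, hup]
    have hXp : X (p j) = p j := by rw [hX j]; simp [hp, hpu]
    have hXa : X (a j) = 0 := by rw [hX j]; simp [hua j j hjN, hpa j j hjN]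
    let R : ℝ → E →L[𝕜] E := planeRotation 𝕜 (p j) (a j)
    have hRU : ∀ t, R t ∈ unitary (E →L[𝕜] E) :=
      planeRotation_mem_unitary (hp j) (ha j hjN) (hpa j j hjN)
    have hRs : ∀ t, star (R t) = R (-t) := star_planeRotation _ _
    -- continuity in the rotation angle
    let W : ℝ → E →L[𝕜] E := fun t => (w.map (letterOp X Z (R t * U))).prod
    have hWc : Continuous W := by
      refine continuous_list_prod w fun l _ => ?_
      cases l with
      | none => exact continuous_const
      | some i =>
        have : Continuous R := continuous_planeRotation _ _
        exact ((this.mul continuous_const).mul continuous_const).mul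
          (this.mul continuous_const).star
    have hW0 : W 0 = (w.map (letterOp X Z U)).prod := by
      simp only [W, R, planeRotation_zero, one_mul]
    have hev : ∀ᶠ t in 𝓝 (0 : ℝ), ‖W t * X
        - spokeProduct X (fun j => rankOne 𝕜 (u j) (u j)) N m‖ < ε / 2 := by
      have hc : Continuous fun t => ‖W t * X
          - spokeProduct X (fun j => rankOne 𝕜 (u j) (u j)) N m‖ :=
        ((hWc.mul continuous_const).sub continuous_const).norm
      refine hc.continuousAt.eventually_lt continuousAt_const ?_
      rw [hW0]
      exact hw
    -- The angle comes first, small enough not to spoil the word found so far; only then the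
    -- exponent `r`, which may be huge because `cos² t` is close to 1.
    obtain ⟨t, ⟨ht, ht1⟩, ht0⟩ := (((hev.and (gt_mem_nhds (show (0 : ℝ) < 1 by norm_num))).filter_mono
      nhdsWithin_le_nhds).and (self_mem_nhdsWithin : Set.Ioi (0 : ℝ) ∈ 𝓝[>] 0)).exists
    have ht0' : (0 : ℝ) < t := ht0
    have hcos : Real.cos t ^ 2 < 1 := by
      have := Real.sin_pos_of_pos_of_lt_pi ht0' (by linarith [Real.pi_gt_three])
      nlinarith [Real.sin_sq_add_cos_sq t, sq_nonneg (Real.cos t)]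
    obtain ⟨r, hr⟩ := exists_pow_lt_of_lt_one (half_pos hε) hcos
    refine ⟨R t * U, mul_mem (hRU t) hU, w ++ (List.replicate r [none, some (j + 1)]).flatten,
      ?_, ?_⟩
    · intro i hi
      rw [← hj] at hi
      refine Commute.mul_left ?_ (hcomm i (by omega))
      exact commute_planeRotation (hZs i) (hZp j i (by omega)) (by rw [hZa j hjN, if_pos hi]) t
    -- The earlier tilts commute with `Z (j + 1)`, so `U` cancels and only the new tilt acts in this
    -- letter.
    have hZ' : letterOp X Z (R t * U) (some (j + 1)) = R t * Z (j + 1) * R (-t) := by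
      simp only [letterOp, star_mul, hRs]
      calc R t * U * Z (j + 1) * (star U * R (-t))
          = R t * (U * Z (j + 1)) * star U * R (-t) := by simp only [mul_assoc]
        _ = R t * (Z (j + 1) * U) * star U * R (-t) := by rw [(hcomm (j + 1) le_rfl).eq]
        _ = R t * Z (j + 1) * (U * star U) * R (-t) := by simp only [mul_assoc]
        _ = _ := by rw [Unitary.mul_star_self_of_mem hU, mul_one]
    have hprod : ((w ++ (List.replicate r [none, some (j + 1)]).flatten).map
        (letterOp X Z (R t * U))).prod = W t * (X * (R t * Z (j + 1) * R (-t))) ^ r := by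
      rw [List.map_append, List.prod_append, List.map_flatten, List.map_replicate, List.prod_flatten,
        List.map_replicate, List.prod_replicate]
      simp only [List.map_cons, List.map_nil, List.prod_cons, List.prod_nil, mul_one, hZ']
      rfl
    have hYu : (X * (R t * Z (j + 1) * R (-t))) (u j) = u j := by
      have h1 : ∀ s, R s (u j) = u j := planeRotation_apply_of_orthogonal (hup j)
        (inner_eq_zero_symm.1 (hua j j hjN))
      simp only [mul_apply_eq_comp, h1, hZu j (j + 1) hjN, hXu]
    have hYp : (X * (R t * Z (j + 1) * R (-t))) (p j) = ((Real.cos t ^ 2 : ℝ) : 𝕜) • p j :=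
      compression_planeRotation (hp j) (hpa j j hjN) hXp hXa (hZp j _ hjN)
        (by rw [hZa j hjN, if_neg (by omega)]) t
    have hpow : ∀ n : ℕ, (X * (R t * Z (j + 1) * R (-t))) ^ n * X
        = rankOne 𝕜 (u j) (u j) + (((Real.cos t ^ 2) ^ n : ℝ) : 𝕜) • rankOne 𝕜 (p j) (p j) := by
      intro n
      induction n with
      | zero => simpa using hX j
      | succ n ihn =>
        have hcomp : ∀ (T : E →L[𝕜] E) (x : E), T * rankOne 𝕜 x x = rankOne 𝕜 (T x) x :=
          fun T x => comp_rankOne _ _ _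
        rw [pow_succ', mul_assoc, ihn, mul_add, mul_smul_comm, hcomp, hcomp, hYu, hYp, map_smul,
          smul_apply, smul_smul, pow_succ _ n]
        push_cast
        rfl
    have hXQ : X * rankOne 𝕜 (u j) (u j) = rankOne 𝕜 (u j) (u j) := by
      rw [ContinuousLinearMap.mul_def, comp_rankOne, hXu]
    have hQ : ‖rankOne 𝕜 (u j) (u j)‖ = 1 := by rw [norm_rankOne, hu, one_mul]
    have hP : ‖rankOne 𝕜 (p j) (p j)‖ = 1 := by rw [norm_rankOne, hp, one_mul]
    have hW1 : ‖W t‖ ≤ 1 := norm_list_prod_le_one _ fun b hb => by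
      obtain ⟨l, -, rfl⟩ := List.mem_map.1 hb
      exact norm_letterOp_le hX1 hZ1 (mul_mem (hRU t) hU) l
    rw [hprod, mul_assoc, hpow, spokeProduct, ← hj]
    have hsplit : W t * (rankOne 𝕜 (u j) (u j)
          + (((Real.cos t ^ 2) ^ r : ℝ) : 𝕜) • rankOne 𝕜 (p j) (p j))
          - spokeProduct X (fun j => rankOne 𝕜 (u j) (u j)) N m * rankOne 𝕜 (u j) (u j)
        = (W t * X - spokeProduct X (fun j => rankOne 𝕜 (u j) (u j)) N m) * rankOne 𝕜 (u j) (u j)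
          + W t * ((((Real.cos t ^ 2) ^ r : ℝ) : 𝕜) • rankOne 𝕜 (p j) (p j)) := by
      rw [sub_mul, mul_assoc, hXQ, mul_add]
      abel
    rw [hsplit]
    have h1 := norm_mul_le (W t * X - spokeProduct X (fun j => rankOne 𝕜 (u j) (u j)) N m)
      (rankOne 𝕜 (u j) (u j))
    have h2 := norm_mul_le (W t) ((((Real.cos t ^ 2) ^ r : ℝ) : 𝕜) • rankOne 𝕜 (p j) (p j))
    rw [norm_smul, hP, mul_one, RCLike.norm_ofReal, abs_of_nonneg (by positivity)] at h2
    rw [hQ, mul_one] at h1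
    have h3 : ‖W t‖ * (Real.cos t ^ 2) ^ r ≤ (Real.cos t ^ 2) ^ r :=
      mul_le_of_le_one_left (by positivity) hW1
    refine (norm_add_le _ _).trans_lt ?_
    linarith

end Spokes

/-! ### The quarter turn. -/

section QuarterTurn

open InnerProductSpace

/-- The level of a coordinate: the two coordinates of the plane have the top level `N`. -/
def coordLevel (N : ℕ) : Fin 2 ⊕ Fin N → ℕ := Sum.elim (fun _ => N) fun i => i

/-- The coordinate projection onto the levels `≥ j`. -/
noncomputable def levelProj (𝕜 : Type*) [RCLike 𝕜] (N j : ℕ) :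
    EuclideanSpace 𝕜 (Fin 2 ⊕ Fin N) →L[𝕜] EuclideanSpace 𝕜 (Fin 2 ⊕ Fin N) :=
  diagOp 𝕜 fun i => if j ≤ coordLevel N i then 1 else 0

variable {𝕜 : Type*} [RCLike 𝕜]

/-- The unit vector at the angle `t` in the plane of the first two coordinates. -/
noncomputable def planeVector (𝕜 : Type*) [RCLike 𝕜] (N : ℕ) (t : ℝ) :
    EuclideanSpace 𝕜 (Fin 2 ⊕ Fin N) :=
  ((Real.cos t : ℝ) : 𝕜) • EuclideanSpace.single (Sum.inl 0) 1
    + ((Real.sin t : ℝ) : 𝕜) • EuclideanSpace.single (Sum.inl 1) 1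

theorem planeVector_inl_zero (N : ℕ) (t : ℝ) :
    planeVector 𝕜 N t (Sum.inl 0) = (Real.cos t : ℝ) := by simp [planeVector, RCLike.real_smul_eq_coe_mul]

theorem planeVector_inl_one (N : ℕ) (t : ℝ) :
    planeVector 𝕜 N t (Sum.inl 1) = (Real.sin t : ℝ) := by simp [planeVector, RCLike.real_smul_eq_coe_mul]

theorem planeVector_inr (N : ℕ) (t : ℝ) (i : Fin N) :
    planeVector 𝕜 N t (Sum.inr i) = 0 := by simp [planeVector]

theorem inner_planeVector_left (N : ℕ) (t : ℝ) (x : EuclideanSpace 𝕜 (Fin 2 ⊕ Fin N)) :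
    inner 𝕜 (planeVector 𝕜 N t) x
      = ((Real.cos t : ℝ) : 𝕜) * x (Sum.inl 0) + ((Real.sin t : ℝ) : 𝕜) * x (Sum.inl 1) := by
  rw [planeVector, inner_add_left, inner_smul_left, inner_smul_left,
    EuclideanSpace.inner_single_left, EuclideanSpace.inner_single_left, RCLike.conj_ofReal,
    RCLike.conj_ofReal, map_one, one_mul, one_mul]

theorem inner_planeVector (N : ℕ) (s t : ℝ) :
    inner 𝕜 (planeVector 𝕜 N s) (planeVector 𝕜 N t) = ((Real.cos (s - t) : ℝ) : 𝕜) := by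
  rw [Real.cos_sub, inner_planeVector_left, planeVector_inl_zero, planeVector_inl_one]
  push_cast
  rfl

theorem norm_planeVector (N : ℕ) (t : ℝ) : ‖planeVector 𝕜 N t‖ = 1 := by
  have h := inner_planeVector (𝕜 := 𝕜) N t t
  rw [inner_self_eq_norm_sq_to_K, sub_self, Real.cos_zero] at h
  have h2 : ‖planeVector 𝕜 N t‖ ^ 2 = 1 := by exact_mod_cast h
  exact (pow_eq_one_iff_of_nonneg (norm_nonneg _) two_ne_zero).1 h2

theorem levelProj_planeVector (N : ℕ) {j : ℕ} (hj : j ≤ N) (t : ℝ) :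
    levelProj 𝕜 N j (planeVector 𝕜 N t) = planeVector 𝕜 N t := by
  ext i
  rcases i with i | i <;> simp [levelProj, planeVector, diagOp_apply, coordLevel, hj]

/-- Every rotated orthonormal pair spans the same plane, so one operator `X` splits along each spoke
and its normal. -/
theorem levelProj_top (N : ℕ) (t : ℝ) : levelProj 𝕜 N N
    = rankOne 𝕜 (planeVector 𝕜 N t) (planeVector 𝕜 N t)
      + rankOne 𝕜 (planeVector 𝕜 N (t + Real.pi / 2)) (planeVector 𝕜 N (t + Real.pi / 2)) := by
  have hcs : (Real.cos t : 𝕜) ^ 2 + (Real.sin t : 𝕜) ^ 2 = 1 := by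
    have := Real.cos_sq_add_sin_sq t
    exact_mod_cast this
  ext x i
  simp only [levelProj, diagOp_apply, add_apply, rankOne_apply, PiLp.add_apply, PiLp.smul_apply,
    smul_eq_mul, inner_planeVector_left, Real.cos_add_pi_div_two, Real.sin_add_pi_div_two]
  rcases i with i | i
  · fin_cases i
    · simp only [Fin.zero_eta, coordLevel, Sum.elim_inl, le_refl, if_true, planeVector_inl_zero,
        Real.cos_add_pi_div_two]
      push_cast
      linear_combination (-x (Sum.inl 0)) * hcs
    · simp only [Fin.mk_one, coordLevel, Sum.elim_inl, le_refl, if_true, planeVector_inl_one,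
        Real.sin_add_pi_div_two]
      push_cast
      linear_combination (-x (Sum.inl 1)) * hcs
  · have hi : ¬ N ≤ i := by omega
    simp [planeVector_inr, coordLevel, hi]

theorem norm_levelProj_le (N j : ℕ) : ‖levelProj 𝕜 N j‖ ≤ 1 :=
  norm_diagOp_le _ zero_le_one fun i => by split_ifs <;> simp

/-- Each line projection turns the vector by `θ` at the cost of one factor `cos θ`. -/
theorem spokeProduct_apply_planeVector (N : ℕ) (θ : ℝ) (m : ℕ) (hm : m ≤ N) :
    spokeProduct (levelProj 𝕜 N N) (fun j => rankOne 𝕜 (planeVector 𝕜 N ((j + 1 : ℕ) * θ))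
      (planeVector 𝕜 N ((j + 1 : ℕ) * θ))) N m (planeVector 𝕜 N ((N - m : ℕ) * θ))
      = ((Real.cos θ ^ m : ℝ) : 𝕜) • planeVector 𝕜 N (N * θ) := by
  induction m with
  | zero => simp [spokeProduct, levelProj_planeVector]
  | succ m ih =>
    have h1 : N - (m + 1) + 1 = N - m := by omega
    have h2 : ((N - m : ℕ) : ℝ) * θ - ((N - (m + 1) : ℕ) : ℝ) * θ = θ := by
      rw [← h1]; push_cast; ring
    rw [spokeProduct, mul_apply_eq_comp, rankOne_apply, h1, inner_planeVector, h2, map_smul,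
      ih (by omega), smul_smul, pow_succ']
    push_cast
    rfl

/-- For x = π/(2N), the bound cos x ≥ 1 - x²/2 and Bernoulli's inequality limit the loss to N x²/2,
which is of order 1/N. -/
theorem exists_one_sub_cos_pow_lt {ε : ℝ} (hε : 0 < ε) :
    ∃ N : ℕ, 0 < N ∧ 1 - Real.cos (Real.pi / 2 / N) ^ N < ε := by
  obtain ⟨N, hN⟩ := exists_nat_gt (max 2 (2 / ε))
  have hN2 : (2 : ℝ) < N := (le_max_left _ _).trans_lt hN
  have hNε : 2 / ε < N := (le_max_right _ _).trans_lt hN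
  have hNpos : (0 : ℝ) < N := by linarith
  refine ⟨N, by exact_mod_cast hNpos, ?_⟩
  set x := Real.pi / 2 / N with hx
  have hxN : x * N = Real.pi / 2 := by rw [hx]; field_simp
  have hx0 : 0 < x := by positivity
  have hpi := Real.pi_lt_four
  have hx1 : x * N < 2 := by rw [hxN]; linarith
  have hx1' : x < 1 := by nlinarith
  have h1 := Real.one_sub_sq_div_two_le_cos (x := x)
  have h2 := one_add_mul_le_pow (a := Real.cos x - 1) (by linarith [Real.neg_one_le_cos x]) N
  rw [add_sub_cancel] at h2
  have h3 : x ^ 2 / 2 * N < ε := by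
    have h4 : 2 < N * ε := by rwa [div_lt_iff₀ hε] at hNε
    have h5 : (x * N) ^ 2 < 4 := by nlinarith [mul_pos hx0 hNpos]
    have h6 : x ^ 2 / 2 * N * N < ε * N := by nlinarith
    exact lt_of_mul_lt_mul_right h6 hNpos.le
  nlinarith

/-- A quarter turn, up to `ε`, by a word in a fixed projection of rank two and in the projections
of a decreasing chain. -/
theorem exists_quarter_turn (𝕜 : Type*) [RCLike 𝕜] {ε : ℝ} (hε : 0 < ε) :
    ∃ (N : ℕ), ∃ U ∈ unitary (EuclideanSpace 𝕜 (Fin 2 ⊕ Fin N) →L[𝕜]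
      EuclideanSpace 𝕜 (Fin 2 ⊕ Fin N)), ∃ w : List (Option ℕ),
      ‖(w.map (letterOp (levelProj 𝕜 N N) (levelProj 𝕜 N) U)).prod
        (EuclideanSpace.single (Sum.inl 0) 1) - EuclideanSpace.single (Sum.inl 1) 1‖ < ε := by
  obtain ⟨N, hN0, hN⟩ := exists_one_sub_cos_pow_lt (half_pos hε)
  have : Nontrivial (EuclideanSpace 𝕜 (Fin 2 ⊕ Fin N)) :=
    ⟨⟨planeVector 𝕜 N 0, 0, fun h => by simpa [h] using norm_planeVector (𝕜 := 𝕜) N 0⟩⟩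
  set θ := Real.pi / 2 / N with hθ
  -- `u` are the spokes and `p` their normals in the plane; `a j` is the auxiliary basis vector at
  -- level `j`, kept by `Z j` and killed by `Z (j + 1)`.
  obtain ⟨U, hU, w, -, hw⟩ := exists_word_near_spokeProduct (𝕜 := 𝕜) (N := N)
    (X := levelProj 𝕜 N N) (Z := levelProj 𝕜 N)
    (u := fun j => planeVector 𝕜 N ((j + 1 : ℕ) * θ))
    (p := fun j => planeVector 𝕜 N ((j + 1 : ℕ) * θ + Real.pi / 2))
    (a := fun j => if h : j < N then EuclideanSpace.single (Sum.inr ⟨j, h⟩) 1 else 0)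
    (norm_levelProj_le N N) (norm_levelProj_le N) (fun j => star_diagOp _)
    (fun j => levelProj_top N _) (fun j => norm_planeVector N _) (fun j => norm_planeVector N _)
    (fun j => by rw [inner_planeVector]; simp)
    (fun j hj => by simp [hj])
    (fun i j hj => by simp [hj, inner_planeVector_left])
    (fun i j hj => by simp [hj, inner_planeVector_left])
    (fun i j hj => levelProj_planeVector N hj _) (fun i j hj => levelProj_planeVector N hj _)
    (fun i hi j => by
      ext l
      rcases l with l | l
      · split_ifs <;> simp [levelProj, diagOp_apply]
      · rcases eq_or_ne l ⟨i, hi⟩ with rfl | hl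
        · split_ifs with hji <;> simp [levelProj, diagOp_apply, coordLevel, hji]
        · split_ifs <;> simp [levelProj, diagOp_apply, hl])
    N le_rfl (half_pos hε)
  refine ⟨N, U, hU, w, ?_⟩
  have h0 : planeVector 𝕜 N 0 = EuclideanSpace.single (Sum.inl 0) 1 := by simp [planeVector]
  have h1 : planeVector 𝕜 N (N * θ) = EuclideanSpace.single (Sum.inl 1) 1 := by
    have : (N : ℝ) * θ = Real.pi / 2 := by rw [hθ]; field_simp
    simp [planeVector, this]
  have h2 := spokeProduct_apply_planeVector (𝕜 := 𝕜) N θ N le_rfl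
  rw [Nat.sub_self, Nat.cast_zero, zero_mul] at h2
  have h3 := (ContinuousLinearMap.le_opNorm _ (planeVector 𝕜 N 0)).trans_lt
    (by rw [norm_planeVector, mul_one]; exact hw)
  rw [sub_apply, mul_apply_eq_comp, levelProj_planeVector N le_rfl, h2] at h3
  rw [← h0, ← h1]
  have h4 : ‖((Real.cos θ ^ N : ℝ) : 𝕜) • planeVector 𝕜 N (N * θ) - planeVector 𝕜 N (N * θ)‖
      < ε / 2 := by
    have h5 : ((Real.cos θ ^ N : ℝ) : 𝕜) • planeVector 𝕜 N (N * θ) - planeVector 𝕜 N (N * θ)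
        = ((Real.cos θ ^ N - 1 : ℝ) : 𝕜) • planeVector 𝕜 N (N * θ) := by
      push_cast; rw [sub_smul, one_smul]
    rw [h5, norm_smul, norm_planeVector, mul_one, RCLike.norm_ofReal, abs_sub_comm, abs_of_nonneg]
    · exact hN
    · have h6 : |Real.cos θ ^ N| ≤ 1 := by
        rw [abs_pow]; exact pow_le_one₀ (abs_nonneg _) (Real.abs_cos_le_one θ)
      linarith [le_abs_self (Real.cos θ ^ N)]
  refine (norm_sub_le_norm_sub_add_norm_sub _ (((Real.cos θ ^ N : ℝ) : 𝕜) • planeVector 𝕜 N (N * θ))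
    _).trans_lt ?_
  linarith

end QuarterTurn

/-! ### One contraction whose powers give the whole chain. -/

section ChainOperator

variable {𝕜 : Type*} [RCLike 𝕜]

/-- A positive contraction whose powers approximate all the projections of a rotated chain,
written as `c * c` with a small complementary operator `s`. -/
theorem exists_chain_operator (N : ℕ) {U : EuclideanSpace 𝕜 (Fin 2 ⊕ Fin N) →L[𝕜]
      EuclideanSpace 𝕜 (Fin 2 ⊕ Fin N)}
    (hU : U ∈ unitary (EuclideanSpace 𝕜 (Fin 2 ⊕ Fin N) →L[𝕜] EuclideanSpace 𝕜 (Fin 2 ⊕ Fin N)))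
    {η ε : ℝ} (hη : 0 < η) (hη1 : η < 1) (hε : 0 < ε) :
    ∃ (c s : EuclideanSpace 𝕜 (Fin 2 ⊕ Fin N) →L[𝕜] EuclideanSpace 𝕜 (Fin 2 ⊕ Fin N))
      (k : ℕ → ℕ), star c = c ∧ star s = s ∧ c * c + s * s = 1 ∧ ‖s‖ ≤ η ∧
        ∀ j, ‖(c * c) ^ k j - U * levelProj 𝕜 N j * star U‖ ≤ ε := by
  obtain ⟨τ, k, hτ0, hτη, hk⟩ := exists_separating_powers (pow_pos hη 2)
    (pow_lt_one₀ hη.le hη1 two_ne_zero) hε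
  have hτ1 : ∀ i, 0 ≤ 1 - τ i := fun i => by
    linarith [hτη i, pow_lt_one₀ hη.le hη1 two_ne_zero]
  have hUU : star U * U = 1 := Unitary.star_mul_self_of_mem hU
  have hconj : ∀ φ ψ : Fin 2 ⊕ Fin N → ℝ, U * diagOp 𝕜 φ * star U * (U * diagOp 𝕜 ψ * star U)
      = U * diagOp 𝕜 (φ * ψ) * star U := fun φ ψ => by
    calc _ = U * diagOp 𝕜 φ * (star U * U) * diagOp 𝕜 ψ * star U := by simp only [mul_assoc]
      _ = _ := by rw [hUU, mul_one, mul_assoc U, diagOp_mul]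
  have hstar : ∀ φ : Fin 2 ⊕ Fin N → ℝ, star (U * diagOp 𝕜 φ * star U)
      = U * diagOp 𝕜 φ * star U := fun φ => by
    simp only [star_mul, star_star, star_diagOp, mul_assoc]
  have hnorm : ∀ T, ‖U * T * star U‖ = ‖T‖ := fun T => by
    rw [CStarRing.norm_mul_mem_unitary _ (Unitary.star_mem hU), CStarRing.norm_mem_unitary_mul _ hU]
  have hone : U * diagOp 𝕜 1 * star U = 1 := by
    rw [diagOp_one, mul_one, Unitary.mul_star_self_of_mem hU]
  have hpow : ∀ (φ : Fin 2 ⊕ Fin N → ℝ) (n : ℕ), (U * diagOp 𝕜 φ * star U) ^ n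
      = U * diagOp 𝕜 (φ ^ n) * star U := fun φ n => by
    induction n with
    | zero => rw [pow_zero, pow_zero, hone]
    | succ n ih => rw [pow_succ, ih, hconj, pow_succ]
  have hcc : ((fun i => √(1 - τ (coordLevel N i))) * fun i => √(1 - τ (coordLevel N i)))
      = fun i => 1 - τ (coordLevel N i) := by
    ext i; exact Real.mul_self_sqrt (hτ1 _)
  have hss : ((fun i => √(τ (coordLevel N i))) * fun i => √(τ (coordLevel N i)))
      = fun i => τ (coordLevel N i) := by
    ext i; exact Real.mul_self_sqrt (hτ0 _).le
  refine ⟨U * diagOp 𝕜 (fun i => √(1 - τ (coordLevel N i))) * star U,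
    U * diagOp 𝕜 (fun i => √(τ (coordLevel N i))) * star U, k, hstar _, hstar _, ?_, ?_, ?_⟩
  · rw [hconj, hconj, ← add_mul, ← mul_add, diagOp_add, hcc, hss, ← hone]
    congr 3
    ext i
    simp
  · rw [hnorm]
    refine norm_diagOp_le _ hη.le fun i => ?_
    rw [abs_of_nonneg (Real.sqrt_nonneg _)]
    exact Real.sqrt_le_iff.2 ⟨hη.le, hτη _⟩
  · intro j
    rw [hconj, hpow, levelProj, ← sub_mul, ← mul_sub, diagOp_sub, hnorm, hcc]
    exact norm_diagOp_le _ hε.le fun i => hk _ _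

end ChainOperator

/-! ### Embeddings of coordinate spaces by orthonormal families. -/

section Combination

variable {𝕜 : Type*} [RCLike 𝕜] {H : Type*} [NormedAddCommGroup H] [InnerProductSpace 𝕜 H]
  {ι : Type*} [Fintype ι]

/-- The linear map sending the standard basis to the family `v`. -/
def combination (𝕜 : Type*) [RCLike 𝕜] {H : Type*} [NormedAddCommGroup H] [InnerProductSpace 𝕜 H]
    {ι : Type*} [Fintype ι] (v : ι → H) : EuclideanSpace 𝕜 ι →ₗ[𝕜] H where
  toFun x := ∑ i, x i • v i
  map_add' x y := by simp [add_smul, Finset.sum_add_distrib]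
  map_smul' a x := by simp [mul_smul, Finset.smul_sum]

theorem combination_apply (v : ι → H) (x : EuclideanSpace 𝕜 ι) :
    combination 𝕜 v x = ∑ i, x i • v i := rfl

theorem combination_single [DecidableEq ι] (v : ι → H) (i : ι) :
    combination 𝕜 v (EuclideanSpace.single i 1) = v i := by
  simp [combination_apply, ite_smul]

theorem combination_mem (v : ι → H) (x : EuclideanSpace 𝕜 ι) {M : Submodule 𝕜 H}
    (h : ∀ i, v i ∈ M) : combination 𝕜 v x ∈ M :=
  M.sum_mem fun i _ => M.smul_mem _ (h i)

theorem inner_combination_eq_zero {v : ι → H} {y : H} (h : ∀ i, inner 𝕜 y (v i) = 0)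
    (x : EuclideanSpace 𝕜 ι) : inner 𝕜 y (combination 𝕜 v x) = 0 := by
  simp [combination_apply, inner_sum, inner_smul_right, h]

theorem combination_inner_combination_eq_zero {κ : Type*} [Fintype κ] {v : ι → H} {v' : κ → H}
    (h : ∀ i j, inner 𝕜 (v i) (v' j) = 0) (x : EuclideanSpace 𝕜 ι) (y : EuclideanSpace 𝕜 κ) :
    inner 𝕜 (combination 𝕜 v x) (combination 𝕜 v' y) = 0 :=
  inner_combination_eq_zero (fun j => inner_eq_zero_symm.1
    (inner_combination_eq_zero (fun i => inner_eq_zero_symm.1 (h i j)) x)) y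

theorem inner_combination {v : ι → H} (h1 : ∀ i, ‖v i‖ = 1)
    (h : ∀ i j, i ≠ j → inner 𝕜 (v i) (v j) = 0) (x y : EuclideanSpace 𝕜 ι) :
    inner 𝕜 (combination 𝕜 v x) (combination 𝕜 v y) = inner 𝕜 x y := by
  have hv : Orthonormal 𝕜 v := ⟨h1, fun i j hij => h i j hij⟩
  simp only [combination_apply, hv.inner_sum, PiLp.inner_apply, RCLike.inner_apply]
  exact Finset.sum_congr rfl fun i _ => mul_comm _ _

theorem norm_combination {v : ι → H} (h1 : ∀ i, ‖v i‖ = 1)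
    (h : ∀ i j, i ≠ j → inner 𝕜 (v i) (v j) = 0) (x : EuclideanSpace 𝕜 ι) :
    ‖combination 𝕜 v x‖ = ‖x‖ := by
  rw [@norm_eq_sqrt_re_inner 𝕜, @norm_eq_sqrt_re_inner 𝕜, inner_combination h1 h]

theorem norm_sum_smul_le (v : ι → H) (x : EuclideanSpace 𝕜 ι) {C : ι → ℝ}
    (h : ∀ i, ‖v i‖ ≤ C i) : ‖∑ i, x i • v i‖ ≤ (∑ i, C i) * ‖x‖ := by
  rw [Finset.sum_mul]
  refine (norm_sum_le _ _).trans (Finset.sum_le_sum fun i _ => ?_)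
  rw [norm_smul, mul_comm]
  exact mul_le_mul (h i) (PiLp.norm_apply_le x i) (norm_nonneg _) ((norm_nonneg _).trans (h i))

theorem norm_combination_sub_le (v v' : ι → H) (x : EuclideanSpace 𝕜 ι) {C : ι → ℝ}
    (h : ∀ i, ‖v i - v' i‖ ≤ C i) :
    ‖combination 𝕜 v x - combination 𝕜 v' x‖ ≤ (∑ i, C i) * ‖x‖ := by
  rw [combination_apply, combination_apply, ← Finset.sum_sub_distrib]
  simp only [← smul_sub]
  exact norm_sum_smul_le _ _ h

end Combination

/-! ### Overlapping blocks of coordinates and their graphs. -/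

section Blocks

/-- Coordinates: the main ones, and for every block the auxiliary and the extra ones. -/
abbrev BlockIndex : Type := ℕ ⊕ (ℕ × ℕ) ⊕ (ℕ × (Fin 2 ⊕ ℕ))

/-- The coordinates of a block: two consecutive main ones, and the auxiliary ones. -/
def blockPos (n N : ℕ) : Fin 2 ⊕ Fin N → BlockIndex :=
  Sum.elim (fun i => Sum.inl (n + i)) fun i => Sum.inr (Sum.inl (n, i))

/-- The extra coordinates of a block. -/
def blockExt (n N : ℕ) (i : Fin 2 ⊕ Fin N) : BlockIndex :=
  Sum.inr (Sum.inr (n, Sum.map id Fin.val i))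

theorem blockPos_injective (n N : ℕ) : Function.Injective (blockPos n N) := by
  rintro (i | i) (j | j) h <;> simp [blockPos] at h ⊢ <;> omega

theorem blockExt_injective (n N : ℕ) : Function.Injective (blockExt n N) := by
  rintro (i | i) (j | j) h <;> simp [blockExt] at h ⊢ <;> omega

theorem blockPos_ne_blockExt (n N m N' : ℕ) (i : Fin 2 ⊕ Fin N) (j : Fin 2 ⊕ Fin N') :
    blockPos n N i ≠ blockExt m N' j := by
  rcases i with i | i <;> simp [blockPos, blockExt]

theorem blockPos_ne_blockPos {n m : ℕ} (h : n + 1 < m ∨ m + 1 < n) (N N' : ℕ)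
    (i : Fin 2 ⊕ Fin N) (j : Fin 2 ⊕ Fin N') : blockPos n N i ≠ blockPos m N' j := by
  rcases i with i | i <;> rcases j with j | j <;> simp [blockPos] <;> omega

theorem blockExt_ne_blockExt {n m : ℕ} (h : n ≠ m) (N N' : ℕ)
    (i : Fin 2 ⊕ Fin N) (j : Fin 2 ⊕ Fin N') : blockExt n N i ≠ blockExt m N' j := by
  simp [blockExt, h]

theorem aux_ne_blockPos {n m : ℕ} (h : n ≠ m) (N' i : ℕ) (j : Fin 2 ⊕ Fin N') :
    (Sum.inr (Sum.inl (n, i)) : BlockIndex) ≠ blockPos m N' j := by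
  rcases j with j | j <;> simp [blockPos, h]

/-- Nearly equal orthogonal vectors in the subspaces `L k`, and the operators of the blocks. The
subspace `zero` projects onto the coordinates of all blocks, the subspaces `one` and `two` carry the
graphs of the even and of the odd blocks. -/
structure BlockSystem {𝕜 : Type*} [RCLike 𝕜] {H : Type*} [NormedAddCommGroup H]
    [InnerProductSpace 𝕜 H] {K : ℕ} (L : Fin K → ClosedSubmodule 𝕜 H) where
  f : BlockIndex → Fin K → H
  f_mem : ∀ i k, f i k ∈ L k
  f_norm : ∀ i k, ‖f i k‖ = 1
  f_orth : ∀ i j k l, i ≠ j → inner 𝕜 (f i k) (f j l) = 0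
  δ : BlockIndex → ℝ
  f_close : ∀ i k l, ‖f i k - f i l‖ ≤ δ i
  N : ℕ → ℕ
  c : ∀ n, EuclideanSpace 𝕜 (Fin 2 ⊕ Fin (N n)) →L[𝕜] EuclideanSpace 𝕜 (Fin 2 ⊕ Fin (N n))
  s : ∀ n, EuclideanSpace 𝕜 (Fin 2 ⊕ Fin (N n)) →L[𝕜] EuclideanSpace 𝕜 (Fin 2 ⊕ Fin (N n))
  star_c : ∀ n, star (c n) = c n
  star_s : ∀ n, star (s n) = s n
  c_mul_c_add : ∀ n, c n * c n + s n * s n = 1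
  η : ℕ → ℝ
  norm_s_le : ∀ n, ‖s n‖ ≤ η n
  η_le_one : ∀ n, η n ≤ 1
  zero : Fin K
  one : Fin K
  two : Fin K
  zero_ne_one : zero ≠ one
  zero_ne_two : zero ≠ two
  one_ne_two : one ≠ two

namespace BlockSystem

variable {𝕜 : Type*} [RCLike 𝕜] {H : Type*} [NormedAddCommGroup H] [InnerProductSpace 𝕜 H]
  {K : ℕ} {L : Fin K → ClosedSubmodule 𝕜 H} (B : BlockSystem L)

/-- The subspace which carries the graph of the block `n`. -/
def role (n : ℕ) : Fin K := if Even n then B.one else B.two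

theorem role_ne_zero (n : ℕ) : B.role n ≠ B.zero := by
  unfold role; split_ifs
  exacts [B.zero_ne_one.symm, B.zero_ne_two.symm]

theorem role_eq_role_iff (m n : ℕ) : B.role m = B.role n ↔ (Even m ↔ Even n) := by
  unfold role
  split_ifs with h1 h2 h2 <;> simp [h1, h2, B.one_ne_two, B.one_ne_two.symm]

/-- Distinct blocks of equal parity are at least two apart, so they share no main coordinate. -/
theorem role_apart {m n : ℕ} (h : B.role m = B.role n) (hmn : m ≠ n) :
    m + 1 < n ∨ n + 1 < m := by
  rw [role_eq_role_iff, Nat.even_iff, Nat.even_iff] at h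
  omega

/-- The embedding of the block `n` by the vectors in `L k`. -/
def emb (n : ℕ) (k : Fin K) : EuclideanSpace 𝕜 (Fin 2 ⊕ Fin (B.N n)) →ₗ[𝕜] H :=
  combination 𝕜 fun i => B.f (blockPos n (B.N n) i) k

/-- The embedding of the extra copy of the block `n`. -/
def embExt (n : ℕ) (k : Fin K) : EuclideanSpace 𝕜 (Fin 2 ⊕ Fin (B.N n)) →ₗ[𝕜] H :=
  combination 𝕜 fun i => B.f (blockExt n (B.N n) i) k

/-- The graph map of the block `n`. -/
def graph (n : ℕ) (k : Fin K) (x : EuclideanSpace 𝕜 (Fin 2 ⊕ Fin (B.N n))) : H :=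
  B.emb n k (B.c n x) + B.embExt n k (B.s n x)

theorem inner_emb (n : ℕ) (k : Fin K) (x y) :
    inner 𝕜 (B.emb n k x) (B.emb n k y) = inner 𝕜 x y :=
  inner_combination (fun _ => B.f_norm _ _)
    (fun _ _ hij => B.f_orth _ _ _ _ ((blockPos_injective _ _).ne hij)) x y

theorem inner_embExt (n : ℕ) (k : Fin K) (x y) :
    inner 𝕜 (B.embExt n k x) (B.embExt n k y) = inner 𝕜 x y :=
  inner_combination (fun _ => B.f_norm _ _)
    (fun _ _ hij => B.f_orth _ _ _ _ ((blockExt_injective _ _).ne hij)) x y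

theorem norm_emb (n : ℕ) (k : Fin K) (x) : ‖B.emb n k x‖ = ‖x‖ :=
  norm_combination (fun _ => B.f_norm _ _)
    (fun _ _ hij => B.f_orth _ _ _ _ ((blockPos_injective _ _).ne hij)) x

theorem norm_embExt (n : ℕ) (k : Fin K) (x) : ‖B.embExt n k x‖ = ‖x‖ :=
  norm_combination (fun _ => B.f_norm _ _)
    (fun _ _ hij => B.f_orth _ _ _ _ ((blockExt_injective _ _).ne hij)) x

theorem inner_emb_embExt (n m : ℕ) (k l : Fin K) (x y) :
    inner 𝕜 (B.emb n k x) (B.embExt m l y) = 0 :=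
  combination_inner_combination_eq_zero
    (fun i j => B.f_orth _ _ _ _ (blockPos_ne_blockExt _ _ _ _ i j)) x y

theorem inner_embExt_emb (n m : ℕ) (k l : Fin K) (x y) :
    inner 𝕜 (B.embExt n k x) (B.emb m l y) = 0 :=
  inner_eq_zero_symm.1 (B.inner_emb_embExt m n l k y x)

theorem inner_emb_emb_of_apart {n m : ℕ} (h : n + 1 < m ∨ m + 1 < n) (k l : Fin K) (x y) :
    inner 𝕜 (B.emb n k x) (B.emb m l y) = 0 :=
  combination_inner_combination_eq_zero
    (fun i j => B.f_orth _ _ _ _ (blockPos_ne_blockPos h _ _ i j)) x y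

theorem inner_embExt_embExt_of_ne {n m : ℕ} (h : n ≠ m) (k l : Fin K) (x y) :
    inner 𝕜 (B.embExt n k x) (B.embExt m l y) = 0 :=
  combination_inner_combination_eq_zero
    (fun i j => B.f_orth _ _ _ _ (blockExt_ne_blockExt h _ _ i j)) x y

theorem inner_c_left (n : ℕ) (x y) : inner 𝕜 (B.c n x) y = inner 𝕜 x (B.c n y) := by
  conv_rhs => rw [← B.star_c n, ContinuousLinearMap.star_eq_adjoint,
    ContinuousLinearMap.adjoint_inner_right]

theorem inner_s_left (n : ℕ) (x y) : inner 𝕜 (B.s n x) y = inner 𝕜 x (B.s n y) := by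
  conv_rhs => rw [← B.star_s n, ContinuousLinearMap.star_eq_adjoint,
    ContinuousLinearMap.adjoint_inner_right]

theorem c_c_add_s_s (n : ℕ) (x) : B.c n (B.c n x) + B.s n (B.s n x) = x :=
  congrArg (fun T => T x) (B.c_mul_c_add n)

theorem norm_c_apply_le (n : ℕ) (x) : ‖B.c n x‖ ≤ ‖x‖ := by
  have h : inner 𝕜 (B.c n x) (B.c n x) + inner 𝕜 (B.s n x) (B.s n x) = inner 𝕜 x x := by
    rw [inner_c_left, inner_s_left, ← inner_add_right, c_c_add_s_s]
  have h2 := congrArg RCLike.re h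
  rw [map_add, ← norm_sq_eq_re_inner, ← norm_sq_eq_re_inner, ← norm_sq_eq_re_inner] at h2
  refine (pow_le_pow_iff_left₀ (norm_nonneg _) (norm_nonneg _) two_ne_zero).1 ?_
  linarith [sq_nonneg ‖B.s n x‖]

theorem norm_s_apply_le (n : ℕ) (x) : ‖B.s n x‖ ≤ B.η n * ‖x‖ :=
  (ContinuousLinearMap.le_opNorm _ _).trans
    (mul_le_mul_of_nonneg_right (B.norm_s_le n) (norm_nonneg _))

/-- The identity `c² + s² = 1` makes the graph map isometric. -/
theorem inner_graph_graph (n : ℕ) (k : Fin K) (x y) :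
    inner 𝕜 (B.graph n k x) (B.graph n k y) = inner 𝕜 x y := by
  simp only [graph, inner_add_left, inner_add_right, inner_emb, inner_embExt, inner_emb_embExt,
    inner_embExt_emb, inner_c_left, inner_s_left, add_zero, zero_add]
  rw [← inner_add_right, c_c_add_s_s]

theorem inner_graph_emb (n : ℕ) (k : Fin K) (x y) :
    inner 𝕜 (B.graph n k x) (B.emb n k y) = inner 𝕜 x (B.c n y) := by
  rw [graph, inner_add_left, inner_emb, inner_embExt_emb, inner_c_left, add_zero]

theorem inner_graph_emb_of_apart {n m : ℕ} (h : n + 1 < m ∨ m + 1 < n) (k l : Fin K) (x y) :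
    inner 𝕜 (B.graph n k x) (B.emb m l y) = 0 := by
  rw [graph, inner_add_left, B.inner_emb_emb_of_apart h, inner_embExt_emb, add_zero]

theorem inner_graph_graph_of_apart {n m : ℕ} (h : n + 1 < m ∨ m + 1 < n) (k l : Fin K) (x y) :
    inner 𝕜 (B.graph n k x) (B.graph m l y) = 0 := by
  rw [graph, graph, inner_add_left, inner_add_right, inner_add_right,
    B.inner_emb_emb_of_apart h, inner_embExt_emb, B.inner_embExt_embExt_of_ne (by omega),
    inner_emb_embExt]
  simp

theorem graph_mem (n : ℕ) (k : Fin K) (x) : B.graph n k x ∈ L k :=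
  (L k).toSubmodule.add_mem (combination_mem _ _ fun _ => B.f_mem _ _)
    (combination_mem _ _ fun _ => B.f_mem _ _)

/-- The distance of the embedded block to its graph. -/
theorem norm_emb_sub_graph_le (n : ℕ) (k : Fin K) (x) :
    ‖B.emb n k x - B.graph n k (B.c n x)‖ ≤ 2 * B.η n * ‖x‖ := by
  have hη : 0 ≤ B.η n := (norm_nonneg _).trans (B.norm_s_le n)
  -- Since `1 - c² = s²`, both components of the difference carry a factor `s`.
  have h : B.emb n k x - B.graph n k (B.c n x)
      = B.emb n k (B.s n (B.s n x)) - B.embExt n k (B.s n (B.c n x)) := by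
    have h1 : B.emb n k x = B.emb n k (B.c n (B.c n x)) + B.emb n k (B.s n (B.s n x)) := by
      rw [← map_add, c_c_add_s_s]
    rw [h1, graph]
    abel
  have h2 : ‖B.s n (B.s n x)‖ ≤ B.η n * ‖x‖ := by
    have h3 := (B.norm_s_apply_le n (B.s n x)).trans
      (mul_le_of_le_one_left (norm_nonneg _) (B.η_le_one n))
    exact h3.trans (B.norm_s_apply_le n x)
  have h4 : ‖B.s n (B.c n x)‖ ≤ B.η n * ‖x‖ :=
    (B.norm_s_apply_le n _).trans (mul_le_mul_of_nonneg_left (B.norm_c_apply_le n x) hη)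
  rw [h]
  refine (norm_sub_le _ _).trans ?_
  rw [norm_emb, norm_embExt]
  linarith

end BlockSystem

end Blocks

/-! ### The subspaces, and the action of their projections on a block. -/

namespace BlockSystem

variable {𝕜 : Type*} [RCLike 𝕜] {H : Type*} [NormedAddCommGroup H] [InnerProductSpace 𝕜 H]
  {K : ℕ} {L : Fin K → ClosedSubmodule 𝕜 H} (B : BlockSystem L)

/-- The closed span of the main and auxiliary coordinate vectors. -/
noncomputable def baseSpace : ClosedSubmodule 𝕜 H :=
  closedSpan 𝕜 (Set.range fun i : ℕ ⊕ (ℕ × ℕ) => B.f (Sum.map id Sum.inl i) B.zero)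

/-- The closed span of the graphs of the blocks with the role `k`. -/
noncomputable def graphSpace (k : Fin K) : ClosedSubmodule 𝕜 H :=
  closedSpan 𝕜 {x | ∃ n z, B.role n = k ∧ x = B.graph n k z}

/-- The closed span of the main coordinate vectors. -/
noncomputable def mainSpace (k : Fin K) : ClosedSubmodule 𝕜 H :=
  closedSpan 𝕜 (Set.range fun n : ℕ => B.f (Sum.inl n) k)

open Classical in
/-- The subspaces of the `L k` whose iterated projections diverge. -/
noncomputable def space (k : Fin K) : ClosedSubmodule 𝕜 H :=
  if k = B.zero then B.baseSpace else if ∃ n, B.role n = k then B.graphSpace k else B.mainSpace k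

theorem space_zero : B.space B.zero = B.baseSpace := if_pos rfl

theorem space_role (n : ℕ) : B.space (B.role n) = B.graphSpace (B.role n) := by
  rw [space, if_neg (B.role_ne_zero n), if_pos ⟨n, rfl⟩]

theorem space_le (k : Fin K) : B.space k ≤ L k := by
  unfold space
  split_ifs with h1 h2
  · subst h1
    refine closedSpan_le ?_
    rintro _ ⟨i, rfl⟩
    exact B.f_mem _ _
  · refine closedSpan_le ?_
    rintro _ ⟨n, z, -, rfl⟩
    exact B.graph_mem _ _ _
  · refine closedSpan_le ?_
    rintro _ ⟨n, rfl⟩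
    exact B.f_mem _ _

theorem blockPos_mem_baseSpace (n N : ℕ) (i : Fin 2 ⊕ Fin N) :
    B.f (blockPos n N i) B.zero ∈ B.baseSpace.toSubmodule := by
  rcases i with i | i
  · exact subset_closedSpan _ ⟨Sum.inl (n + i), rfl⟩
  · exact subset_closedSpan _ ⟨Sum.inr (n, i), rfl⟩

theorem graph_mem_graphSpace (n : ℕ) (z) :
    B.graph n (B.role n) z ∈ (B.graphSpace (B.role n)).toSubmodule :=
  subset_closedSpan _ ⟨n, z, rfl, rfl⟩

/-- The total closeness of the coordinate vectors of a block. -/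
def blockGap (n : ℕ) : ℝ := ∑ i, B.δ (blockPos n (B.N n) i)

theorem norm_emb_sub_emb_le (n : ℕ) (k l : Fin K) (x) :
    ‖B.emb n k x - B.emb n l x‖ ≤ B.blockGap n * ‖x‖ :=
  norm_combination_sub_le _ _ _ fun _ => B.f_close _ _ _

theorem blockGap_nonneg (n : ℕ) : 0 ≤ B.blockGap n :=
  Finset.sum_nonneg fun _ _ => (norm_nonneg _).trans (B.f_close _ B.zero B.zero)

/-- Closeness of a block's coordinate vectors in terms of an antitone bound. -/
theorem blockGap_le {d : ℕ → ℝ} (hd : Antitone d)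
    (hδ : B.δ = Sum.elim d (Sum.elim (fun p => d p.1) fun p => d p.1)) (n : ℕ) :
    B.blockGap n ≤ (B.N n + 2) * d n := by
  have h : ∀ i, B.δ (blockPos n (B.N n) i) ≤ d n := by
    intro i
    rw [hδ]
    rcases i with i | i
    · exact hd (Nat.le_add_right n i)
    · exact le_rfl
  refine (Finset.sum_le_card_nsmul _ _ _ fun i _ => h i).trans (le_of_eq ?_)
  rw [Finset.card_univ, Fintype.card_sum, Fintype.card_fin, Fintype.card_fin, nsmul_eq_mul]
  push_cast
  ring

theorem emb_single_inl (n : ℕ) (k : Fin K) (i : Fin 2) :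
    B.emb n k (EuclideanSpace.single (Sum.inl i) 1) = B.f (Sum.inl (n + i)) k :=
  combination_single _ _

variable [CompleteSpace H]

/-- The orthogonal projection onto `B.space k`. -/
noncomputable def proj (k : Fin K) : H → H := fun x => (B.space k).toSubmodule.starProjection x

theorem proj_eq_of_space_eq {k : Fin K} {M : ClosedSubmodule 𝕜 H} (h : B.space k = M) (x : H) :
    B.proj k x = M.toSubmodule.starProjection x := by
  subst h
  rfl

theorem norm_proj_sub_le (k : Fin K) (x y : H) : ‖B.proj k x - B.proj k y‖ ≤ ‖x - y‖ :=
  norm_starProjection_sub_le _ _ _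

/-- Graph vectors `z` of this block pair with `x` as `⟨z, c x⟩`, the graph map is isometric, and the
other graphs of the same role are orthogonal to the block. -/
theorem proj_role_emb (n : ℕ) (x) :
    B.proj (B.role n) (B.emb n (B.role n) x) = B.graph n (B.role n) (B.c n x) := by
  rw [B.proj_eq_of_space_eq (B.space_role _)]
  refine starProjection_closedSpan_eq (B.graph_mem_graphSpace n _) ?_
  rintro _ ⟨m, z, hm, rfl⟩
  rw [inner_sub_right]
  rcases eq_or_ne m n with rfl | hmn
  · rw [inner_graph_emb, inner_graph_graph, sub_self]
  · rw [B.inner_graph_emb_of_apart (B.role_apart hm hmn),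
      B.inner_graph_graph_of_apart (B.role_apart hm hmn), sub_self]

theorem proj_zero_emb (n : ℕ) (x) : B.proj B.zero (B.emb n B.zero x) = B.emb n B.zero x := by
  rw [B.proj_eq_of_space_eq B.space_zero]
  exact Submodule.starProjection_eq_self_iff.2
    (combination_mem _ _ (B.blockPos_mem_baseSpace _ _))

/-- The extra coordinates are orthogonal to the base space, so only the first component of the graph
survives. -/
theorem proj_zero_graph (n : ℕ) (k : Fin K) (x) :
    B.proj B.zero (B.graph n k x) = B.proj B.zero (B.emb n k (B.c n x)) := by
  have h : B.proj B.zero (B.embExt n k (B.s n x)) = 0 := by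
    rw [B.proj_eq_of_space_eq B.space_zero]
    refine starProjection_closedSpan_eq (Submodule.zero_mem _) ?_
    rintro _ ⟨i, rfl⟩
    rw [sub_zero]
    refine inner_combination_eq_zero (fun j => B.f_orth _ _ _ _ ?_) _
    rcases i with i | i <;> simp [blockExt]
  have h2 : B.proj B.zero (B.graph n k x)
      = B.proj B.zero (B.emb n k (B.c n x)) + B.proj B.zero (B.embExt n k (B.s n x)) :=
    map_add _ _ _
  rw [h2, h, add_zero]

/-- Here `c²` appears as a product of two projections. One gap is paid for replacing the vectors of
`zero` by those of the role, one for going back. -/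
theorem norm_proj_zero_proj_role_sub_le (n : ℕ) (x) :
    ‖B.proj B.zero (B.proj (B.role n) (B.emb n B.zero x))
      - B.emb n B.zero ((B.c n * B.c n) x)‖ ≤ 2 * B.blockGap n * ‖x‖ := by
  have h1 : ‖B.proj B.zero (B.proj (B.role n) (B.emb n B.zero x))
      - B.proj B.zero (B.proj (B.role n) (B.emb n (B.role n) x))‖ ≤ B.blockGap n * ‖x‖ :=
    ((B.norm_proj_sub_le _ _ _).trans (B.norm_proj_sub_le _ _ _)).trans
      (B.norm_emb_sub_emb_le _ _ _ _)
  have h2 : B.proj B.zero (B.proj (B.role n) (B.emb n (B.role n) x))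
      = B.proj B.zero (B.emb n (B.role n) ((B.c n * B.c n) x)) := by
    rw [proj_role_emb, proj_zero_graph]; rfl
  have h3 : ‖B.proj B.zero (B.emb n (B.role n) ((B.c n * B.c n) x))
      - B.emb n B.zero ((B.c n * B.c n) x)‖ ≤ B.blockGap n * ‖x‖ := by
    conv_lhs => rw [← B.proj_zero_emb n ((B.c n * B.c n) x)]
    refine (B.norm_proj_sub_le _ _ _).trans ((B.norm_emb_sub_emb_le _ _ _ _).trans ?_)
    exact mul_le_mul_of_nonneg_left ((B.norm_c_apply_le n _).trans (B.norm_c_apply_le n x))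
      (B.blockGap_nonneg n)
  have h4 := norm_sub_le_norm_sub_add_norm_sub
    (B.proj B.zero (B.proj (B.role n) (B.emb n B.zero x)))
    (B.proj B.zero (B.proj (B.role n) (B.emb n (B.role n) x))) (B.emb n B.zero ((B.c n * B.c n) x))
  rw [h2] at h1 h4
  linarith

/-- All the projections nearly fix the main coordinate vectors. -/
theorem norm_proj_main_sub_le {n : ℕ} {η : ℝ} (h0 : B.η n ≤ η) (h1 : B.η (n + 1) ≤ η)
    (k : Fin K) : ‖B.proj k (B.f (Sum.inl (n + 1)) B.zero) - B.f (Sum.inl (n + 1)) B.zero‖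
      ≤ 2 * η + B.δ (Sum.inl (n + 1)) := by
  have hη : 0 ≤ η := ((norm_nonneg _).trans (B.norm_s_le n)).trans h0
  have hclose := B.f_close (Sum.inl (n + 1)) B.zero k
  have key : ∃ y ∈ B.space k, ‖B.f (Sum.inl (n + 1)) k - y‖ ≤ 2 * η := by
    have hgr : ∀ (m : ℕ) (i : Fin 2), m + i = n + 1 → B.η m ≤ η → B.role m = k →
        ∃ y ∈ B.space k, ‖B.f (Sum.inl (n + 1)) k - y‖ ≤ 2 * η := by
      rintro m i hmi hm rfl
      refine ⟨B.graph m (B.role m) (B.c m (EuclideanSpace.single (Sum.inl i) 1)), ?_, ?_⟩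
      · rw [space_role]; exact B.graph_mem_graphSpace _ _
      · have := B.norm_emb_sub_graph_le m (B.role m) (EuclideanSpace.single (Sum.inl i) 1)
        rw [emb_single_inl, hmi, PiLp.norm_single, norm_one, mul_one] at this
        linarith
    by_cases hk0 : k = B.zero
    · refine ⟨B.f (Sum.inl (n + 1)) k, ?_, by simpa using hη⟩
      rw [hk0, space_zero]
      exact subset_closedSpan _ ⟨Sum.inl (n + 1), rfl⟩
    by_cases hkr : ∃ m, B.role m = k
    · obtain ⟨m, hm⟩ := hkr
      -- The vector is the second main one of block `n` and the first of block `n + 1`. These have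
      -- opposite parities, so each graph space has a vector near it.
      by_cases hpar : Even m ↔ Even n
      · exact hgr n 1 rfl h0 (by rw [← hm, eq_comm, role_eq_role_iff, hpar])
      · refine hgr (n + 1) 0 rfl h1 ?_
        rw [← hm, eq_comm, role_eq_role_iff, Nat.even_add_one]
        tauto
    · refine ⟨B.f (Sum.inl (n + 1)) k, ?_, by simpa using hη⟩
      rw [space, if_neg hk0, if_neg hkr]
      exact subset_closedSpan _ ⟨n + 1, rfl⟩
  obtain ⟨y, hy, hyn⟩ := key
  refine (norm_starProjection_sub_self_le _ _ hy).trans ?_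
  have := norm_sub_le_norm_sub_add_norm_sub (B.f (Sum.inl (n + 1)) B.zero)
    (B.f (Sum.inl (n + 1)) k) y
  linarith

/-- Auxiliary coordinates are not shared between blocks, and block `n` has no graph in this
subspace. -/
theorem proj_role_succ_aux (n : ℕ) (i : Fin (B.N n)) :
    B.proj (B.role (n + 1)) (B.f (blockPos n (B.N n) (Sum.inr i)) B.zero) = 0 := by
  rw [B.proj_eq_of_space_eq (B.space_role _)]
  refine starProjection_closedSpan_eq (Submodule.zero_mem _) ?_
  rintro _ ⟨m, z, hm, rfl⟩
  have hmn : n ≠ m := by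
    rintro rfl
    rw [role_eq_role_iff, Nat.even_add_one] at hm
    tauto
  rw [sub_zero, graph, inner_add_left]
  have h1 : inner 𝕜 (B.emb m (B.role (n + 1)) (B.c m z))
      (B.f (blockPos n (B.N n) (Sum.inr i)) B.zero) = 0 :=
    inner_eq_zero_symm.1 (inner_combination_eq_zero (fun j => B.f_orth _ _ _ _
      (aux_ne_blockPos hmn _ _ _)) _)
  have h2 : inner 𝕜 (B.embExt m (B.role (n + 1)) (B.s m z))
      (B.f (blockPos n (B.N n) (Sum.inr i)) B.zero) = 0 :=
    inner_eq_zero_symm.1 (inner_combination_eq_zero (fun j => B.f_orth _ _ _ _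
      (blockPos_ne_blockExt _ _ _ _ _ _)) _)
  rw [h1, h2, add_zero]

/-- On the block `n`, the projection with the role of the adjacent blocks nearly acts as the
projection onto the plane of the two main coordinates. -/
theorem norm_proj_role_succ_sub_le {n : ℕ} {κ : ℝ}
    (h : ∀ i : Fin 2, ‖B.proj (B.role (n + 1)) (B.f (Sum.inl (n + i)) B.zero)
      - B.f (Sum.inl (n + i)) B.zero‖ ≤ κ) (x) :
    ‖B.proj (B.role (n + 1)) (B.emb n B.zero x)
      - B.emb n B.zero (levelProj 𝕜 (B.N n) (B.N n) x)‖ ≤ 2 * κ * ‖x‖ := by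
  have h1 : B.proj (B.role (n + 1)) (B.emb n B.zero x)
      - B.emb n B.zero (levelProj 𝕜 (B.N n) (B.N n) x)
      = ∑ i, x i • (B.proj (B.role (n + 1)) (B.f (blockPos n (B.N n) i) B.zero)
        - (if B.N n ≤ coordLevel (B.N n) i then (1 : 𝕜) else 0) •
          B.f (blockPos n (B.N n) i) B.zero) := by
    simp only [proj, emb, combination_apply, map_sum, map_smul, smul_sub, Finset.sum_sub_distrib]
    congr 1
    refine Finset.sum_congr rfl fun i _ => ?_
    rw [levelProj, diagOp_apply, smul_smul, mul_comm]
    congr 2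
    split_ifs <;> simp
  rw [h1]
  -- Only the two plane coordinates contribute an error; this is the factor 2.
  refine (norm_sum_smul_le _ x (C := Sum.elim (fun _ => κ) fun _ => 0) ?_).trans (le_of_eq ?_)
  · rintro (i | i)
    · simpa [coordLevel, blockPos] using h i
    · have hi : ¬ B.N n ≤ i := by omega
      simp [coordLevel, hi, proj_role_succ_aux]
  · simp

/-- The word in the projections which stands for a letter of the block `n`. -/
def expand (n : ℕ) (κ : ℕ → ℕ) : Option ℕ → List (Fin K)
  | none => [B.role (n + 1)]
  | some j => (List.replicate (κ j) [B.zero, B.role n]).flatten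

theorem norm_foldr_replicate_sub_le (n k : ℕ) {x} (hx : ‖x‖ ≤ 1) :
    ‖((List.replicate k [B.zero, B.role n]).flatten).foldr B.proj (B.emb n B.zero x)
      - B.emb n B.zero (((B.c n * B.c n) ^ k) x)‖ ≤ k * (2 * B.blockGap n) := by
  have h := norm_foldr_sub_le (α := Unit) (fun _ y => B.proj B.zero (B.proj (B.role n) y))
    (fun _ y => (B.c n * B.c n) y) (B.emb n B.zero) {y | ‖y‖ ≤ 1}
    (fun _ y hy => ((B.norm_c_apply_le n _).trans (B.norm_c_apply_le n y)).trans hy)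
    (2 * B.blockGap n) (fun _ y z => (B.norm_proj_sub_le _ _ _).trans (B.norm_proj_sub_le _ _ _))
    (List.replicate k ()) (fun _ _ y hy => (B.norm_proj_zero_proj_role_sub_le n y).trans
      (mul_le_of_le_one_right (mul_nonneg zero_le_two (B.blockGap_nonneg n)) hy)) hx
  have h1 : ∀ (k : ℕ) (y : H), (List.replicate k ()).foldr
      (fun _ y => B.proj B.zero (B.proj (B.role n) y)) y
      = ((List.replicate k [B.zero, B.role n]).flatten).foldr B.proj y := fun k y => by
    induction k with
    | zero => rfl
    | succ k ih => simp [List.replicate_succ, ih]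
  have h2 : ∀ (k : ℕ) (y), (List.replicate k ()).foldr (fun _ y => (B.c n * B.c n) y) y
      = ((B.c n * B.c n) ^ k) y := fun k y => by
    induction k with
    | zero => rfl
    | succ k ih => rw [List.replicate_succ, List.foldr_cons, ih, pow_succ']; rfl
  rw [h1, h2, List.length_replicate] at h
  exact h.1

/-- The word of a block carries one main coordinate vector close to the next one. -/
theorem norm_block_word_sub_le (n : ℕ)
    {U : EuclideanSpace 𝕜 (Fin 2 ⊕ Fin (B.N n)) →L[𝕜] EuclideanSpace 𝕜 (Fin 2 ⊕ Fin (B.N n))}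
    (hU : U ∈ unitary (EuclideanSpace 𝕜 (Fin 2 ⊕ Fin (B.N n)) →L[𝕜]
      EuclideanSpace 𝕜 (Fin 2 ⊕ Fin (B.N n)))) (w : List (Option ℕ)) (κ : ℕ → ℕ) {b ε ε' : ℝ}
    (hw : ‖(w.map (letterOp (levelProj 𝕜 (B.N n) (B.N n)) (levelProj 𝕜 (B.N n)) U)).prod
      (EuclideanSpace.single (Sum.inl 0) 1) - EuclideanSpace.single (Sum.inl 1) 1‖ ≤ ε)
    (hκ : ∀ j, ‖(B.c n * B.c n) ^ κ j - U * levelProj 𝕜 (B.N n) j * star U‖ ≤ ε')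
    (hκb : ∀ j, some j ∈ w → κ j * (2 * B.blockGap n) + ε' ≤ b)
    (hmain : ∀ i : Fin 2, ‖B.proj (B.role (n + 1)) (B.f (Sum.inl (n + i)) B.zero)
      - B.f (Sum.inl (n + i)) B.zero‖ ≤ b / 2) :
    ‖(w.flatMap (B.expand n κ)).foldr B.proj (B.f (Sum.inl n) B.zero)
      - B.f (Sum.inl (n + 1)) B.zero‖ ≤ w.length * b + ε := by
  set S := letterOp (levelProj 𝕜 (B.N n) (B.N n)) (levelProj 𝕜 (B.N n)) U with hS
  have hnt : Nontrivial (EuclideanSpace 𝕜 (Fin 2 ⊕ Fin (B.N n))) :=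
    ⟨⟨planeVector 𝕜 _ 0, 0, fun h => by simpa [h] using norm_planeVector (𝕜 := 𝕜) (B.N n) 0⟩⟩
  have hSn : ∀ l, ‖S l‖ ≤ 1 :=
    norm_letterOp_le (norm_levelProj_le _ _) (norm_levelProj_le (B.N n)) hU
  have hS1 : ∀ l y, ‖S l y‖ ≤ ‖y‖ := fun l y =>
    (ContinuousLinearMap.le_opNorm _ _).trans (mul_le_of_le_one_left (norm_nonneg _) (hSn l))
  let Ball : Set (EuclideanSpace 𝕜 (Fin 2 ⊕ Fin (B.N n))) := {y | ‖y‖ ≤ 1}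
  have hmaps : ∀ l, Set.MapsTo (fun y => S l y) Ball Ball := fun l y hy => (hS1 l y).trans hy
  have hlip : ∀ l (y z : H), ‖(B.expand n κ l).foldr B.proj y - (B.expand n κ l).foldr B.proj z‖
      ≤ ‖y - z‖ := fun l y z => norm_foldr_sub_foldr_le _ B.norm_proj_sub_le _ _ _
  have h0 : EuclideanSpace.single (Sum.inl 0) 1 ∈ Ball := by simp [Ball]
  -- Each letter costs at most `b`: `none` twice the error `b / 2` on main vectors, `some j` the
  -- repeated gaps plus `ε'`.
  have h := norm_foldr_sub_le (fun l y => (B.expand n κ l).foldr B.proj y) (fun l y => S l y)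
    (B.emb n B.zero) Ball hmaps b hlip w ?_ h0
  · rw [foldr_flatMap]
    have h1 := h.1
    rw [foldr_apply_eq_prod, emb_single_inl] at h1
    have h2 : ‖B.emb n B.zero ((w.map S).prod (EuclideanSpace.single (Sum.inl 0) 1))
        - B.f (Sum.inl (n + 1)) B.zero‖ ≤ ε := by
      have h3 := B.emb_single_inl n B.zero 1
      rw [Fin.val_one] at h3
      rw [← h3, ← map_sub, norm_emb]
      exact hw
    refine (norm_sub_le_norm_sub_add_norm_sub _ _ _).trans (add_le_add h1 h2)
  · intro l hl y hy
    cases l with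
    | none =>
      have h4 := B.norm_proj_role_succ_sub_le hmain y
      have hb : 0 ≤ b / 2 := (norm_nonneg _).trans (hmain 0)
      refine h4.trans ?_
      have hy' : ‖y‖ ≤ 1 := hy
      nlinarith
    | some j =>
      have h5 := B.norm_foldr_replicate_sub_le n (κ j) (x := y) hy
      have h6 : ‖B.emb n B.zero (((B.c n * B.c n) ^ κ j) y) - B.emb n B.zero (S (some j) y)‖
          ≤ ε' := by
        rw [← map_sub, norm_emb]
        refine (ContinuousLinearMap.le_opNorm
          ((B.c n * B.c n) ^ κ j - U * levelProj 𝕜 (B.N n) j * star U) y).trans ?_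
        have hy' : ‖y‖ ≤ 1 := hy
        exact (mul_le_of_le_one_right (norm_nonneg _) hy').trans (hκ j)
      exact (norm_sub_le_norm_sub_add_norm_sub _ _ _).trans ((add_le_add h5 h6).trans (hκb j hl))

end BlockSystem

/-! ### Choice of the parameters and divergence. -/

section Assembly

variable {𝕜 : Type*} [RCLike 𝕜] {H : Type*} [NormedAddCommGroup H] [InnerProductSpace 𝕜 H]

theorem one_le_norm_sub_of_orthogonal {x y : H} (hx : ‖x‖ = 1) (hxy : inner 𝕜 x y = 0) :
    1 ≤ ‖x - y‖ := by
  have h := norm_inner_le_norm (𝕜 := 𝕜) x (x - y)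
  rw [inner_sub_right, hxy, sub_zero, inner_self_eq_norm_sq_to_K, hx, one_mul] at h
  simpa using h

variable [CompleteSpace H] {K : ℕ} {L : Fin K → ClosedSubmodule 𝕜 H}

/-- Words of projections which carry each term of a separated sequence close to the next one
give divergent iterated projections. -/
theorem hasDivergentProjections_of_words (M : Fin K → ClosedSubmodule 𝕜 H) (hM : ∀ k, M k ≤ L k)
    (hK : 0 < K) (e : ℕ → H) (he : ∀ n, 1 ≤ ‖e n - e (n + 1)‖) (W : ℕ → List (Fin K))
    (hW : ∀ n k, k ∈ W n) (ε : ℕ → ℝ) (hε : ∀ n, ∑ m ∈ Finset.range n, ε m ≤ 1 / 4)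
    (h : ∀ n, ‖(W n).foldr (fun k x => (M k).toSubmodule.starProjection x) (e n) - e (n + 1)‖
      ≤ ε n) : HasDivergentProjections L := by
  -- `foldr` applies the last letter first, whereas the iteration reads indices forwards; hence the
  -- reversal.
  obtain ⟨k, t, ht0, ht, hk⟩ := exists_concatenation (fun n => (W n).reverse) fun n hn => by
    have := hW n ⟨0, hK⟩
    rw [List.reverse_eq_nil_iff.1 hn] at this
    simp at this
  have hpos : ∀ n, 0 < (W n).reverse.length := fun n => by
    rw [List.length_reverse]
    exact List.length_pos_of_mem (hW n ⟨0, hK⟩)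
  have hmono : StrictMono t := strictMono_nat_of_lt_succ fun n => by
    have := hpos n
    rw [ht]; omega
  have hstep : ∀ n, projIterates M k (e 0) (t (n + 1))
      = (W n).foldr (fun k x => (M k).toSubmodule.starProjection x)
        (projIterates M k (e 0) (t n)) := fun n => by
    rw [ht, projIterates_add_length M k (e 0) (t n) _ (hk n), List.foldl_reverse]
  have hclose : ∀ n, ‖projIterates M k (e 0) (t n) - e n‖ ≤ ∑ m ∈ Finset.range n, ε m := by
    intro n
    induction n with
    | zero => simp [ht0, projIterates]
    | succ n ih =>
      rw [hstep, Finset.sum_range_succ]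
      refine (norm_sub_le_norm_sub_add_norm_sub _ ((W n).foldr
        (fun k x => (M k).toSubmodule.starProjection x) (e n)) _).trans (add_le_add ?_ (h n))
      exact (norm_foldr_sub_foldr_le (fun k x => (M k).toSubmodule.starProjection x)
        (fun k => norm_starProjection_sub_le (M k)) _ _ _).trans ih
  refine ⟨M, e 0, k, hM, fun i => ?_, ?_⟩
  · rw [frequently_atTop]
    intro a
    obtain ⟨j, hj, hji⟩ := List.mem_iff_getElem.1 (List.mem_reverse.2 (hW a i))
    exact ⟨t a + j, hmono.le_apply.trans (Nat.le_add_right _ _), by rw [hk a j hj, hji]⟩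
  · rintro ⟨z, hz⟩
    have hz' := hz.comp hmono.tendsto_atTop
    -- Two errors of at most 1/4 and two below 1/8 cannot bridge the distance 1 between consecutive
    -- targets.
    obtain ⟨n, hn⟩ := Metric.tendsto_atTop.1 hz' (1 / 8) (by norm_num)
    have h1 := hn n le_rfl
    have h2 := hn (n + 1) (Nat.le_succ n)
    rw [Function.comp_apply, dist_eq_norm] at h1 h2
    have h3 := (hclose n).trans (hε n)
    have h4 := (hclose (n + 1)).trans (hε (n + 1))
    have h5 := norm_sub_le_norm_sub_add_norm_sub (e n) (projIterates M k (e 0) (t n)) (e (n + 1))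
    have h6 := norm_sub_le_norm_sub_add_norm_sub (projIterates M k (e 0) (t n)) z (e (n + 1))
    have h7 := norm_sub_le_norm_sub_add_norm_sub z (projIterates M k (e 0) (t (n + 1))) (e (n + 1))
    rw [norm_sub_rev (e n) (projIterates M k (e 0) (t n))] at h5
    rw [norm_sub_rev z (projIterates M k (e 0) (t (n + 1)))] at h7
    linarith [he n]

/-- The order of choices matters: the words depend only on `ε`, then come the chain operators and
their exponents, and last the vectors, whose closeness must beat these exponents. -/
theorem hasDivergentProjections_of_weakly_null (hK : 3 ≤ K) (w : ℕ → H) (hw1 : ∀ n, ‖w n‖ = 1)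
    (hw : ∀ y, Tendsto (fun n => inner 𝕜 y (w n)) atTop (𝓝 0))
    (hd : ∀ k, Tendsto (fun n => ‖w n - (L k).toSubmodule.starProjection (w n)‖) atTop (𝓝 0)) :
    HasDivergentProjections L := by
  let ε : ℕ → ℝ := fun n => (1 / 2) ^ n / 32
  have hε : ∀ n, 0 < ε n := fun n => by positivity
  have hε1 : ∀ n, ε n ≤ 1 := fun n => by
    have : (1 / 2 : ℝ) ^ n ≤ 1 := pow_le_one₀ (by norm_num) (by norm_num)
    simp only [ε]; linarith
  choose N U hU u hu using fun n => exists_quarter_turn 𝕜 (hε n)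
  -- The error allowed per letter, counting the block word and `K` further projections.
  let b : ℕ → ℝ := fun n => ε n / ((u n).length + K + 1)
  have hb : ∀ n, 0 < b n := fun n => div_pos (hε n) (by positivity)
  have hbε : ∀ n, ((u n).length + K) * b n ≤ ε n := fun n => by
    have : ((u n).length + K + 1 : ℝ) * b n = ε n := mul_div_cancel₀ _ (by positivity)
    linarith [hb n]
  have hb1 : ∀ n, b n ≤ 1 := fun n => by
    have h1 : (0 : ℝ) ≤ (u n).length := Nat.cast_nonneg _
    have h2 : (0 : ℝ) ≤ K := Nat.cast_nonneg _
    exact (div_le_self (hε n).le (by linarith)).trans (hε1 n)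
  obtain ⟨h, hanti, hpos, hle⟩ := exists_antitone_pos_le (fun n => b n / 16)
    fun n => div_pos (hb n) (by norm_num)
  choose c s κ hc hs hcs hsη hκ using fun n => exists_chain_operator (N n) (hU n)
    (hpos (n + 1)) (by linarith [hle (n + 1), hb1 (n + 1)]) (half_pos (hb n))
  have hmax : ∀ n, ∃ m : ℕ, ∀ j, some j ∈ u n → κ n j ≤ m := fun n => by
    obtain ⟨m, hm⟩ := (((u n).map fun l => l.elim 0 (κ n)).toFinset).exists_le
    exact ⟨m, fun j hj => hm _ (List.mem_toFinset.2 (List.mem_map.2 ⟨some j, hj, rfl⟩))⟩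
  choose m hm using hmax
  -- The gap of block `n` is at most `(N n + 2) * d n`, and a letter pays twice the gap at most `m
  -- n` times: `b n / 4` in all, beside `b n / 2` for the approximation by powers.
  obtain ⟨d, hdanti, hdpos, hdle⟩ := exists_antitone_pos_le
    (fun n => b n / (8 * (N n + 2) * (m n + 1))) fun n => div_pos (hb n) (by positivity)
  have hdmul : ∀ n, d n * (8 * (N n + 2) * (m n + 1)) ≤ b n := fun n =>
    (le_div_iff₀ (by positivity)).1 (hdle n)
  have hd8 : ∀ n, d n ≤ b n / 8 := fun n => by
    refine (hdle n).trans (div_le_div_of_nonneg_left (hb n).le (by norm_num) ?_)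
    have h1 : (0 : ℝ) ≤ N n := Nat.cast_nonneg _
    have h2 : (0 : ℝ) ≤ m n := Nat.cast_nonneg _
    nlinarith [mul_nonneg h1 h2]
  obtain ⟨f, hf1, hf2, hf3, hf4⟩ := exists_orthogonal_close_vectors L
    (fun G _ δ hδ => exists_close_unit_vectors L hw1 hw hd G hδ)
    (Sum.elim d (Sum.elim (fun p => d p.1) fun p => d p.1) : BlockIndex → ℝ)
    (by rintro (i | i | i) <;> exact hdpos _)
  let B : BlockSystem L :=
    { f := f
      f_mem := hf1
      f_norm := hf2
      f_orth := hf3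
      δ := Sum.elim d (Sum.elim (fun p => d p.1) fun p => d p.1)
      f_close := hf4
      N := N
      c := c
      s := s
      star_c := hc
      star_s := hs
      c_mul_c_add := hcs
      -- Block `n` serves as neighbour of block `n + 1`, so its graph must already meet the
      -- tolerance of that block.
      η := fun n => h (n + 1)
      norm_s_le := hsη
      η_le_one := fun n => by linarith [hle (n + 1), hb1 (n + 1)]
      zero := ⟨0, by omega⟩
      one := ⟨1, by omega⟩
      two := ⟨2, by omega⟩
      zero_ne_one := by simp
      zero_ne_two := by simp
      one_ne_two := by simp }
  have hmain : ∀ n (i : Fin 2) k, ‖B.proj k (B.f (Sum.inl (n + 1 + i)) B.zero)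
      - B.f (Sum.inl (n + 1 + i)) B.zero‖ ≤ b (n + 1) / 2 := by
    intro n i k
    have h1 := B.norm_proj_main_sub_le (n := n + i) (η := h (n + 1)) (hanti (by omega))
      (hanti (by omega)) k
    have h2 : n + i + 1 = n + 1 + (i : ℕ) := by omega
    rw [h2] at h1
    have h3 : B.δ (Sum.inl (n + 1 + i)) ≤ d (n + 1) := hdanti (Nat.le_add_right _ _)
    linarith [hle (n + 1), hd8 (n + 1), hb (n + 1)]
  refine hasDivergentProjections_of_words B.space B.space_le (by omega)
    -- The main vector of index 0 lies in a single block and need not be nearly fixed by every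
    -- projection, so the path starts at index 1.
    (fun n => B.f (Sum.inl (n + 1)) B.zero)
    (fun n => one_le_norm_sub_of_orthogonal (𝕜 := 𝕜) (B.f_norm _ _) (B.f_orth _ _ _ _ (by simp)))
    -- All `K` projections are applied after the block word, so that every index recurs; they hardly
    -- move the vector reached.
    (fun n => List.finRange K ++ (u (n + 1)).flatMap (B.expand (n + 1) (κ (n + 1))))
    (fun n k => List.mem_append_left _ (List.mem_finRange k)) (fun n => 3 * ε (n + 1)) ?_ ?_
  · intro n
    have hsum : ∑ m ∈ Finset.range n, 3 * ε (m + 1) = 3 / 32 * (1 - (1 / 2) ^ n) := by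
      induction n with
      | zero => simp
      | succ n ih =>
        rw [Finset.sum_range_succ, ih]
        simp only [ε]
        ring
    have : (0 : ℝ) < (1 / 2) ^ n := by positivity
    rw [hsum]
    linarith
  · intro n
    have hgap := B.blockGap_le hdanti rfl (n + 1)
    have h1 := B.norm_block_word_sub_le (n + 1) (hU (n + 1)) (u (n + 1)) (κ (n + 1))
      (b := b (n + 1)) (hu (n + 1)).le (hκ (n + 1)) (fun j hj => by
        have h2 : (κ (n + 1) j : ℝ) ≤ m (n + 1) := by exact_mod_cast hm (n + 1) j hj
        have h3 : (κ (n + 1) j : ℝ) * (2 * B.blockGap (n + 1))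
            ≤ m (n + 1) * (2 * ((N (n + 1) + 2) * d (n + 1))) :=
          mul_le_mul h2 (mul_le_mul_of_nonneg_left hgap zero_le_two)
            (mul_nonneg zero_le_two (B.blockGap_nonneg _)) (Nat.cast_nonneg _)
        have h4 : 0 < (N (n + 1) + 2 : ℝ) * d (n + 1) := mul_pos (by positivity) (hdpos _)
        nlinarith [hdmul (n + 1), hb (n + 1)]) (fun i => hmain n i _)
    -- Over a one-point model the word estimate bounds how far the `K` projections move a nearly
    -- fixed vector.
    have h5 := norm_foldr_sub_le B.proj (fun _ (_ : Unit) => ())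
      (fun _ => B.f (Sum.inl (n + 1 + 1)) B.zero) Set.univ (fun _ _ _ => trivial) (b (n + 1) / 2)
      B.norm_proj_sub_le (List.finRange K) (fun k _ _ _ => hmain n 1 k) (x := ()) trivial
    rw [List.length_finRange] at h5
    rw [List.foldr_append]
    have h6 := norm_foldr_sub_foldr_le B.proj B.norm_proj_sub_le (List.finRange K)
      (((u (n + 1)).flatMap (B.expand (n + 1) (κ (n + 1)))).foldr B.proj
        (B.f (Sum.inl (n + 1)) B.zero)) (B.f (Sum.inl (n + 1 + 1)) B.zero)
    refine (norm_sub_le_norm_sub_add_norm_sub _ _ _).trans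
      ((add_le_add (h6.trans h1) h5.1).trans ?_)
    have h7 := hbε (n + 1)
    have h8 : 0 ≤ (K : ℝ) * b (n + 1) := mul_nonneg (Nat.cast_nonneg _) (hb _).le
    have h9 := hε (n + 1)
    nlinarith

end Assembly

theorem mainTheorem3 {𝕜 : Type*} [RCLike 𝕜] {H : Type*} [NormedAddCommGroup H]
    [InnerProductSpace 𝕜 H] [CompleteSpace H] (K : ℕ) (hK : 3 ≤ K)
    (L : Fin K → ClosedSubmodule 𝕜 H) :
    (∀ w : ℕ → H, (∀ n, ‖w n‖ = 1) →
      Tendsto (fun n => toWeakSpace 𝕜 H (w n)) atTop (𝓝 0) →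
      Tendsto (fun n => ⨆ k : Fin K, Metric.infDist (w n) (L k : Set H)) atTop (𝓝 0) →
      HasDivergentProjections L) ∧
    (¬ IsClosed ((∑ k : Fin K, (L k).toSubmoduleᗮ : Submodule 𝕜 H) : Set H) →
      HasDivergentProjections L) := by
  refine ⟨fun w hw1 hw hd => ?_, fun hcl => ?_⟩
  · refine hasDivergentProjections_of_weakly_null hK w hw1 (fun y => ?_) fun k => ?_
    · have h := ((WeakBilin.eval_continuous (topDualPairing 𝕜 H).flip (innerSL 𝕜 y)).tendsto 0).comp
        hw
      have h0 : (topDualPairing 𝕜 H).flip 0 (innerSL 𝕜 y) = 0 := by simp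
      exact h0 ▸ h
    · refine squeeze_zero (fun _ => norm_nonneg _) (fun n => ?_) hd
      rw [← infDist_eq_norm_sub_starProjection]
      exact le_ciSup (f := fun k => Metric.infDist (w n) (L k : Set H)) (Set.finite_range _).bddAbove k
  · obtain ⟨w, hw1, hw, hd⟩ := exists_weakly_null_of_not_isClosed L hcl
    exact hasDivergentProjections_of_weakly_null hK w hw1 hw hd
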